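/- Setting. Let $(\mathcal N,\mathcal E)$ be a finite connected graph of buses, with arbitrarily oriented lines ($(i,j)\in\mathcal E$ implies $(j,i)\notin\mathcal E$). Each bus $j$ carries a finite set $\mathcal N_j=\mathcal N_j^G\sqcup\mathcal N_j^L$ of active units (generators and controllable loads); let $\widetilde{\mathcal N}=\bigsqcup_j\mathcal N_j$, and let $H$ be the signed incidence matrix of a connected communication graph $(\widetilde{\mathcal N},\widetilde{\mathcal E})$. The constants $M_j,D_j,B_{ij},\tau_{k,j},m_{k,j},h_{k,j}$ and the diagonal entries of the diagonal matrices $\Gamma,\widetilde\Gamma$ are positive, and the uncontrollable demands $p^L_{k,j}\in\mathbb R$ are constant. Consider the system with state $(\eta,\psi,\omega,x,p^c)$ $$\dot\eta_{ij}=\omega_i-\omega_j,\quad (i,j)\in\mathcal E,$$ $$M_j\dot\omega_j=\sum_{k\in\mathcal N_j^G}p^M_{k,j}-\sum_{k\in\mathcal N_j^L}d^c_{k,j}-\sum_{k\in\mathcal N_j}p^L_{k,j}-D_j\omega_j-\sum_{i:(j,i)\in\mathcal E}B_{ji}\eta_{ji}+\sum_{i:(i,j)\in\mathcal E}B_{ij}\eta_{ij},\quad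 j\in\mathcal N,$$ $$\tau_{k,j}\dot x_{k,j}=-x_{k,j}+m_{k,j}(u_{k,j}-\omega_j),\quad p^M_{k,j}=x_{k,j}+h_{k,j}(u_{k,j}-\omega_j)\quad (k\in\mathcal N_j^G),$$ $$d^c_{k,j}=-h_{k,j}(u_{k,j}-\omega_j)\quad (k\in\mathcal N_j^L),$$ coupled with the Privacy-Preserving scheme $$\widetilde\Gamma\dot\psi=H^Tp^c,\qquad \Gamma\dot p^c=\widetilde s-H\psi+n,\qquad u=p^c,$$ where $\widetilde s_{k,j}=-p^M_{k,j}+p^L_{k,j}$ for generators and $\widetilde s_{k,j}=d^c_{k,j}+p^L_{k,j}$ for loads. Design condition. Let $\beta_{k,j},\hat\beta_{k,j}>0$ satisfy, for all $k\in\mathcal N_j$, $j\in\mathcal N$, $$\begin{bmatrix}-h_{k,j}-D_j/|\mathcal N_j| & h_{k,j}+\beta_{k,j}/2\\ h_{k,j}+\beta_{k,j}/2 & -h_{k,j}+\hat\beta_{k,j}/2\end{bmatrix}\preceq 0,$$ and let the signal $n$ satisfy $n_{k,j}=n^d_{k,j}+n^f_{k,j}$, where for all $t\ge 0$: $n^d_{k,j}(t)=-\xi_{k,j}(t)\,\dot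 p^c_{k,j}(t)$ with $\xi_{k,j}$ differentiable, $\xi_{k,j}(t)\ge 0$ and $\dot\xi_{k,j}(t)<\hat\beta_{k,j}$; and $|n^f_{k,j}(t)|\le\beta_{k,j}|\omega_j(t)|$. An equilibrium is a state at which all time derivatives vanish for some value of $n$ compatible with the design condition, i.e. (as $n^d=0$ when $\dot p^c=0$) with $|n_{k,j}|\le\beta_{k,j}|\omega_j|$. Theorem. Under the design condition, the set of equilibria is nonempty, every equilibrium has $\omega^*=0$, and every (everywhere differentiable) solution on $[0,\infty)$, from any initial state, converges to the set of equilibria: the distance of the state at time $t$ to this set tends to $0$ as $t\to\infty$. -/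

import Mathlib

open Set Filter Topology

noncomputable section

/-- A power network with its prosumption units and their communication network. `N` is the set of
buses, `G` the set of all generation units and `L` the set of all controllable loads; the active
units are `G ⊕ L`. The units at bus `j` are those that `busG`, `busL` send to `j`. -/
structure PowerSystem (N G L : Type*) where
  /-- the (directed) transmission lines -/
  lines : Finset (N × N)
  lines_oriented : ∀ i j, (i, j) ∈ lines → (j, i) ∉ lines
  lines_connected : (SimpleGraph.fromRel fun i j => (i, j) ∈ lines).Connected
  /-- the bus of a generation unit -/
  busG : G → N
  /-- the bus of a controllable load -/
  busL : L → N
  /-- the (directed) communication links between active units -/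
  links : Finset ((G ⊕ L) × (G ⊕ L))
  links_connected : (SimpleGraph.fromRel fun k l => (k, l) ∈ links).Connected
  /-- line susceptances -/
  B : lines → ℝ
  B_pos : ∀ e, 0 < B e
  /-- inertia -/
  M : N → ℝ
  M_pos : ∀ j, 0 < M j
  /-- generation damping of a bus -/
  D : N → ℝ
  D_pos : ∀ j, 0 < D j
  /-- uncontrollable demand associated with an active unit -/
  pL : G ⊕ L → ℝ
  /-- time constants of generation units -/
  τ : G → ℝ
  τ_pos : ∀ k, 0 < τ k
  /-- droop constants of generation units -/
  m : G → ℝ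
  m_pos : ∀ k, 0 < m k
  /-- damping of active units -/
  h : G ⊕ L → ℝ
  h_pos : ∀ k, 0 < h k
  /-- time constants of the power command dynamics (the diagonal of `Γ`) -/
  γ : G ⊕ L → ℝ
  γ_pos : ∀ k, 0 < γ k
  /-- time constants of the dynamics of `ψ` (the diagonal of `Γ̃`) -/
  γ' : links → ℝ
  γ'_pos : ∀ e, 0 < γ' e

namespace PowerSystem

variable {N G L : Type*} [Fintype N] [Fintype G] [Fintype L]
  [DecidableEq N] [DecidableEq G] [DecidableEq L]

/-- The bus of an active unit. -/
def bus (P : PowerSystem N G L) : G ⊕ L → N := Sum.elim P.busG P.busL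

/-- The number of active units at bus `j`. -/
def numUnits (P : PowerSystem N G L) (j : N) : ℕ := (Finset.univ.filter fun k => P.bus k = j).card

/-- The incidence matrix of the communication graph. -/
def H (P : PowerSystem N G L) : Matrix (G ⊕ L) P.links ℝ := fun k e =>
  (if e.1.1 = k then 1 else 0) - (if e.1.2 = k then 1 else 0)

/-- The state space: tuples `(η, ψ, ω, x, p^c)`. -/
abbrev State (P : PowerSystem N G L) : Type _ :=
  (P.lines → ℝ) × (P.links → ℝ) × (N → ℝ) × (G → ℝ) × (G ⊕ L → ℝ)

/-- power angle differences -/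
abbrev η (P : PowerSystem N G L) (a : P.State) : P.lines → ℝ := a.1

/-- controller states of the communication links -/
abbrev ψ (P : PowerSystem N G L) (a : P.State) : P.links → ℝ := a.2.1

/-- frequency deviations -/
abbrev ω (P : PowerSystem N G L) (a : P.State) : N → ℝ := a.2.2.1

/-- internal states of generation units -/
abbrev x (P : PowerSystem N G L) (a : P.State) : G → ℝ := a.2.2.2.1

/-- power commands -/
abbrev pc (P : PowerSystem N G L) (a : P.State) : G ⊕ L → ℝ := a.2.2.2.2

/-- Power transfer on a line. -/
def p (P : PowerSystem N G L) (a : P.State) (e : P.lines) : ℝ := P.B e * P.η a e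

/-- Control inputs of the active units. -/
def u (P : PowerSystem N G L) (a : P.State) : G ⊕ L → ℝ := P.pc a

/-- Mechanical power injection of a generation unit. -/
def pM (P : PowerSystem N G L) (a : P.State) (k : G) : ℝ :=
  P.x a k + P.h (Sum.inl k) * (P.u a (Sum.inl k) - P.ω a (P.busG k))

/-- Demand of a controllable load. -/
def dc (P : PowerSystem N G L) (a : P.State) (k : L) : ℝ :=
  -(P.h (Sum.inr k) * (P.u a (Sum.inr k) - P.ω a (P.busL k)))

/-- The vector of all generation (with a minus sign) and all controllable and uncontrollable
demand. -/
def sTilde (P : PowerSystem N G L) (a : P.State) (k : G ⊕ L) : ℝ :=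
  Sum.elim (fun g => -P.pM a g) (fun l => P.dc a l) k + P.pL k

/-- The equations of motion: in state `a`, with privacy-enhancing signal `n`, the time derivative
of the state is `a'`. -/
structure Dynamics (P : PowerSystem N G L) (n : G ⊕ L → ℝ) (a a' : P.State) : Prop where
  angle : ∀ e : P.lines, P.η a' e = P.ω a e.1.1 - P.ω a e.1.2
  swing : ∀ j : N, P.M j * P.ω a' j =
    ∑ k with P.busG k = j, P.pM a k - ∑ k with P.busL k = j, P.dc a k
      - ∑ k with P.bus k = j, P.pL k - P.D j * P.ω a j
      - ∑ e : P.lines with e.1.1 = j, P.p a e + ∑ e : P.lines with e.1.2 = j, P.p a e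
  generation : ∀ k : G, P.τ k * P.x a' k =
    -P.x a k + P.m k * (P.u a (Sum.inl k) - P.ω a (P.busG k))
  link : ∀ e : P.links, P.γ' e * P.ψ a' e = P.H.transpose.mulVec (P.pc a) e
  command : ∀ k : G ⊕ L, P.γ k * P.pc a' k = P.sTilde a k - P.H.mulVec (P.ψ a) k + n k

/-- `a` is a solution on `[0, ∞)`, with time derivative `a'`, for the privacy-enhancing
signal `n`. -/
def IsSolution (P : PowerSystem N G L) (n : ℝ → G ⊕ L → ℝ) (a a' : ℝ → P.State) : Prop :=
  ∀ t, 0 ≤ t → HasDerivWithinAt a (a' t) (Ici 0) t ∧ P.Dynamics (n t) (a t) (a' t)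

/-- The linear matrix inequality on the design constants. -/
def DesignLMI (P : PowerSystem N G L) (β βhat : G ⊕ L → ℝ) : Prop :=
  ∀ k : G ⊕ L, Matrix.PosSemidef
    (-(!![-P.h k - P.D (P.bus k) / P.numUnits (P.bus k), P.h k + β k / 2;
          P.h k + β k / 2, -P.h k + βhat k / 2] : Matrix (Fin 2) (Fin 2) ℝ))

/-- The conditions on the privacy-enhancing signal `n` along the curve `a` with time
derivative `a'`. The signals `ξ` and `nf` may depend on time and on the trajectory. -/
def DesignSignal (P : PowerSystem N G L) (β βhat : G ⊕ L → ℝ) (n : ℝ → G ⊕ L → ℝ)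
    (a a' : ℝ → P.State) : Prop :=
  ∃ nd nf ξ ξ' : ℝ → G ⊕ L → ℝ, ∀ t, 0 ≤ t → ∀ k : G ⊕ L,
    n t k = nd t k + nf t k ∧
    nd t k = -ξ t k * P.pc (a' t) k ∧
    0 ≤ ξ t k ∧ HasDerivWithinAt (fun s => ξ s k) (ξ' t k) (Ici 0) t ∧ ξ' t k < βhat k ∧
    |nf t k| ≤ β k * |P.ω (a t) (P.bus k)|

/-- The equilibria: the states at which all time derivatives vanish for some admissible value `n`
of the privacy-enhancing signal. As `ṗ^c = 0` there, `n^d = 0`, so `n = n^f` is admissible when it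
satisfies the bound on `n^f`. -/
def equilibria (P : PowerSystem N G L) (β : G ⊕ L → ℝ) : Set P.State :=
  {a | ∃ n : G ⊕ L → ℝ, (∀ k, |n k| ≤ β k * |P.ω a (P.bus k)|) ∧ P.Dynamics n a 0}

end PowerSystem

end

/-!
The error `b = a - a₀` of a solution with respect to an equilibrium `a₀` obeys a linear equation
(`PowerSystem.ErrorDynamics`) in which the part `-ξ ṗᶜ` of the privacy signal acts as a
time-varying inertia `γ + ξ` of the power command. The equilibrium is chosen depending on the
initial state (`PowerSystem.exists_equilibrium`): `η - η₀` and `ψ - ψ₀` have no circulating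
component at time `0`, hence never (`PowerSystem.orthogonal_of_errorDynamics`), and so they are
controlled by the forces they exert on the buses and units (`exists_sum_sq_le_divergence`). The
solution then converges to `a₀` itself.

The network and the links are lossless, so the natural storage function
`∑ M ω² + ∑ B η² + ∑ γ' ψ² + ∑ (γ + ξ) (pᶜ)² + ∑ (τ / m) x²` (all coordinates being errors, up to
the factor `1 / 2`) changes only through the units. The growth `ξ' ≤ βhat` of the inertia and the
bounded part of the signal are absorbed by the matrix inequality, but only with a semidefinite
margin. Counting the physical part `∑ M ω² + ∑ B η²` with a weight `1 + δ` slightly larger than `1`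
makes the dissipation definite in `(ω, pᶜ, x)` (`unit_dissipation`,
`PowerSystem.exists_energyDeriv_le`). Adding a small multiple of the cross terms
`velocity * force` (`PowerSystem.cross`) also dissipates the line and link forces, the latter with
weight `1 / (γ + ξ)` (`PowerSystem.exists_crossDeriv_le`).

Since `ξ` grows at most linearly, the resulting Lyapunov function `Y` satisfies
`Y' ≤ -r Y / (1 + t)` (`PowerSystem.exists_energy_le`), and hence decays like a negative power of
`1 + t`. No compactness or invariance argument is needed, which matters because `ξ` may be
unbounded and `ξ'` may approach `βhat`.

An equilibrium has a common frequency `c`; summing the swing and command equations gives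
`(∑ D) c = ∑ n` with `|∑ n| ≤ (∑ β) |c|`, and the matrix inequality forces `∑ β < ∑ D`, so `c = 0`.
-/

set_option linter.unusedSectionVars false

noncomputable section

/-! ### Flows on directed graphs -/

/-- The signed incidence matrix of a directed graph with edge set `E`: the column of the edge
`(i, j)` is `+1` at its source `i` and `-1` at its target `j`. -/
def incidence {V : Type*} [DecidableEq V] (E : Finset (V × V)) : Matrix V E ℝ := fun k e =>
  (if e.1.1 = k then 1 else 0) - (if e.1.2 = k then 1 else 0)

lemma incidence_mulVec {V : Type*} [DecidableEq V] (E : Finset (V × V)) (z : E → ℝ) (j : V) :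
    (incidence E).mulVec z j =
      ∑ e : E with e.1.1 = j, z e - ∑ e : E with e.1.2 = j, z e := by
  simp only [Matrix.mulVec, dotProduct, incidence, sub_mul, ite_mul, one_mul, zero_mul,
    Finset.sum_sub_distrib, Finset.sum_filter]

lemma incidence_transpose_mulVec {V : Type*} [Fintype V] [DecidableEq V]
    (E : Finset (V × V)) (v : V → ℝ) (e : E) :
    (incidence E).transpose.mulVec v e = v e.1.1 - v e.1.2 := by
  simp [Matrix.mulVec, dotProduct, incidence, sub_mul, Finset.sum_sub_distrib]

/-- The incidence matrix and its transpose are adjoint. -/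
lemma sum_incidence_mulVec_mul {V : Type*} [Fintype V] [DecidableEq V]
    (E : Finset (V × V)) (z : E → ℝ) (v : V → ℝ) :
    ∑ j, (incidence E).mulVec z j * v j = ∑ e : E, z e * (v e.1.1 - v e.1.2) := by
  have h := Matrix.dotProduct_mulVec v (incidence E) z
  rw [← Matrix.mulVec_transpose] at h
  simp only [dotProduct, incidence_transpose_mulVec] at h
  simpa only [mul_comm] using h

lemma sum_incidence_mulVec {V : Type*} [Fintype V] [DecidableEq V]
    (E : Finset (V × V)) (z : E → ℝ) :
    ∑ j, (incidence E).mulVec z j = 0 := by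
  simpa using sum_incidence_mulVec_mul E z 1

/-- A function that agrees at the ends of every edge of a connected graph is constant. -/
lemma eq_of_connected {V : Type*} {E : Finset (V × V)}
    (hE : (SimpleGraph.fromRel fun i j => (i, j) ∈ E).Connected) {v : V → ℝ}
    (hv : ∀ e : E, v e.1.1 = v e.1.2) (i j : V) : v i = v j := by
  obtain ⟨w⟩ := hE.preconnected i j
  induction w with
  | nil => rfl
  | cons h _ ih =>
    rw [SimpleGraph.fromRel_adj] at h
    rcases h.2 with h' | h'
    · exact (hv ⟨_, h'⟩).trans ih
    · exact (hv ⟨_, h'⟩).symm.trans ih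

/-- The weighted Laplacian of a connected graph maps onto the vectors with zero sum: adding the
rank-one map `v ↦ (∑ v) • 1` makes it injective, hence surjective. -/
lemma exists_laplacian_eq {V : Type*} [Fintype V] [DecidableEq V] {E : Finset (V × V)}
    (hE : (SimpleGraph.fromRel fun i j => (i, j) ∈ E).Connected) {w : E → ℝ}
    (hw : ∀ e, 0 < w e) {s : V → ℝ} (hs : ∑ j, s j = 0) :
    ∃ v : V → ℝ, (incidence E).mulVec (fun e => (v e.1.1 - v e.1.2) / w e) = s := by
  have : Nonempty V := hE.nonempty
  let T : (V → ℝ) →ₗ[ℝ] (V → ℝ) :=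
    { toFun := fun v j =>
        (incidence E).mulVec (fun e => (v e.1.1 - v e.1.2) / w e) j + ∑ i, v i
      map_add' := fun v v' => by
        ext j
        simp only [Matrix.mulVec, dotProduct, Pi.add_apply, Finset.sum_add_distrib]
        rw [add_add_add_comm, ← Finset.sum_add_distrib, ← Finset.sum_add_distrib]
        congr 1
        exact Finset.sum_congr rfl fun e _ => by ring
      map_smul' := fun c v => by
        ext j
        simp only [Matrix.mulVec, dotProduct, Pi.smul_apply, smul_eq_mul, RingHom.id_apply,
          mul_add, Finset.mul_sum]
        congr 1
        exact Finset.sum_congr rfl fun e _ => by ring }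
  have hT : ∀ v j, T v j =
      (incidence E).mulVec (fun e => (v e.1.1 - v e.1.2) / w e) j + ∑ i, v i := fun _ _ => rfl
  have hsum : ∀ v, ∑ j, T v j = Fintype.card V * ∑ i, v i := fun v => by
    simp only [hT, Finset.sum_add_distrib, sum_incidence_mulVec, zero_add, Finset.sum_const,
      Finset.card_univ, nsmul_eq_mul]
  have hcard : (Fintype.card V : ℝ) ≠ 0 := by exact_mod_cast Fintype.card_ne_zero
  have hinj : Function.Injective T := by
    rw [← LinearMap.ker_eq_bot, LinearMap.ker_eq_bot']
    intro v hv
    have h0 : ∑ i, v i = 0 := by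
      have h := hsum v
      rw [hv] at h
      simpa [hcard] using h.symm
    have h1 : ∑ e : E, (v e.1.1 - v e.1.2) / w e * (v e.1.1 - v e.1.2) = 0 := by
      rw [← sum_incidence_mulVec_mul E (fun e => (v e.1.1 - v e.1.2) / w e) v]
      refine Finset.sum_eq_zero fun j _ => ?_
      have h := hT v j
      rw [hv, h0, add_zero] at h
      rw [← h, Pi.zero_apply, zero_mul]
    have h2 : ∀ e : E, v e.1.1 = v e.1.2 := fun e => by
      have h := (Finset.sum_eq_zero_iff_of_nonneg fun e _ => by
        rw [div_mul_eq_mul_div]; exact div_nonneg (mul_self_nonneg _) (hw e).le).1 h1 e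
          (Finset.mem_univ e)
      have := (hw e).ne'
      simpa [this, sub_eq_zero] using h
    have h3 : ∀ i j, v i = v j := eq_of_connected hE h2
    ext i
    have h4 : ∑ j, v j = Fintype.card V * v i := by
      rw [Finset.sum_congr rfl fun j _ => h3 j i]; simp
    rw [h0] at h4
    simpa [hcard] using h4.symm
  obtain ⟨v, hv⟩ := (LinearMap.injective_iff_surjective.1 hinj) s
  have h0 : ∑ i, v i = 0 := by
    have h := hsum v
    rw [hv, hs] at h
    simpa [hcard] using h.symm
  refine ⟨v, ?_⟩
  ext j
  have h := hT v j
  rw [hv, h0, add_zero] at h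
  exact h.symm

/-- On a connected graph, a flow with prescribed divergence `s` of zero sum exists, and it can be
chosen to differ from a given flow `z₀` by a `w`-weighted potential difference, that is, by
something `w`-orthogonal to all circulations. -/
lemma exists_flow {V : Type*} [Fintype V] [DecidableEq V] {E : Finset (V × V)}
    (hE : (SimpleGraph.fromRel fun i j => (i, j) ∈ E).Connected) {w : E → ℝ}
    (hw : ∀ e, 0 < w e) {s : V → ℝ} (hs : ∑ j, s j = 0) (z₀ : E → ℝ) :
    ∃ z : E → ℝ, (incidence E).mulVec z = s ∧
      ∀ y, (incidence E).mulVec y = 0 → ∑ e, w e * y e * (z₀ e - z e) = 0 := by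
  obtain ⟨v, hv⟩ := exists_laplacian_eq hE hw (s := s - (incidence E).mulVec z₀) (by
    simp only [Pi.sub_apply, Finset.sum_sub_distrib, hs, sum_incidence_mulVec, sub_zero])
  refine ⟨z₀ + fun e => (v e.1.1 - v e.1.2) / w e, ?_, fun y hy => ?_⟩
  · rw [Matrix.mulVec_add, hv, add_sub_cancel]
  · have h := sum_incidence_mulVec_mul E y v
    simp only [hy, Pi.zero_apply, zero_mul, Finset.sum_const_zero] at h
    rw [← neg_eq_zero, ← Finset.sum_neg_distrib, h]
    refine Finset.sum_congr rfl fun e _ => ?_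
    have := (hw e).ne'
    simp only [Pi.add_apply]
    field_simp
    ring

/-- A flow that is `w`-orthogonal to all circulations is controlled by its divergence. -/
lemma exists_sum_sq_le_divergence {V : Type*} [Fintype V] [DecidableEq V]
    (E : Finset (V × V)) {w : E → ℝ} (hw : ∀ e, 0 < w e) :
    ∃ C : ℝ, 0 ≤ C ∧ ∀ z : E → ℝ,
      (∀ y, (incidence E).mulVec y = 0 → ∑ e, w e * y e * z e = 0) →
      ∑ e, z e ^ 2 ≤ C * ∑ j, (incidence E).mulVec z j ^ 2 := by
  let K : Submodule ℝ (E → ℝ) :=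
    { carrier := {z | ∀ y, (incidence E).mulVec y = 0 → ∑ e, w e * y e * z e = 0}
      add_mem' := fun {a b} ha hb y hy => by
        simp only [Pi.add_apply, mul_add, Finset.sum_add_distrib, ha y hy, hb y hy, add_zero]
      zero_mem' := fun y _ => by simp
      smul_mem' := fun c a ha y hy => by
        have h : ∀ e, w e * y e * (c • a) e = c * (w e * y e * a e) := fun e => by
          simp only [Pi.smul_apply, smul_eq_mul]; ring
        simp only [h, ← Finset.mul_sum, ha y hy, mul_zero] }
  let T : K →ₗ[ℝ] (V → ℝ) := (incidence E).mulVecLin.comp K.subtype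
  have hker : LinearMap.ker T = ⊥ := by
    rw [LinearMap.ker_eq_bot']
    intro z hz
    have h := z.2 z.1 hz
    ext e
    have h' := (Finset.sum_eq_zero_iff_of_nonneg fun e _ => by
      rw [mul_assoc]; exact mul_nonneg (hw e).le (mul_self_nonneg _)).1 h e (Finset.mem_univ e)
    simpa [(hw e).ne'] using h'
  obtain ⟨c, -, hc⟩ := T.exists_antilipschitzWith hker
  refine ⟨Fintype.card E * (c : ℝ) ^ 2, by positivity, fun z hz => ?_⟩
  have h1 : ‖z‖ ≤ c * ‖(incidence E).mulVec z‖ := by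
    exact ZeroHomClass.bound_of_antilipschitz T hc ⟨z, hz⟩
  have h2 : ‖(incidence E).mulVec z‖ ≤ √(∑ j, (incidence E).mulVec z j ^ 2) := by
    refine (pi_norm_le_iff_of_nonneg (Real.sqrt_nonneg _)).2 fun j => ?_
    exact Real.abs_le_sqrt (Finset.single_le_sum (f := fun j => (incidence E).mulVec z j ^ 2)
      (fun _ _ => sq_nonneg _) (Finset.mem_univ j))
  have h3 : ∀ e, z e ^ 2 ≤ c ^ 2 * ∑ j, (incidence E).mulVec z j ^ 2 := fun e => by
    have h4 : |z e| ≤ c * √(∑ j, (incidence E).mulVec z j ^ 2) :=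
      (norm_le_pi_norm z e).trans (h1.trans (mul_le_mul_of_nonneg_left h2 c.2))
    have h5 := pow_le_pow_left₀ (abs_nonneg _) h4 2
    rwa [sq_abs, mul_pow, Real.sq_sqrt (Finset.sum_nonneg fun _ _ => sq_nonneg _)] at h5
  calc ∑ e, z e ^ 2 ≤ ∑ _e : E, c ^ 2 * ∑ j, (incidence E).mulVec z j ^ 2 :=
        Finset.sum_le_sum fun e _ => h3 e
    _ = _ := by rw [Finset.sum_const, Finset.card_univ, nsmul_eq_mul, mul_assoc]

/-! ### Equilibria -/

namespace PowerSystem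

variable {N G L : Type*} [Fintype N] [Fintype G] [Fintype L]
  [DecidableEq N] [DecidableEq G] [DecidableEq L]

lemma sum_units_at (P : PowerSystem N G L) (F : G ⊕ L → ℝ) (j : N) :
    ∑ k with P.bus k = j, F k =
      ∑ k with P.busG k = j, F (Sum.inl k) + ∑ k with P.busL k = j, F (Sum.inr k) := by
  rw [Finset.sum_filter, Fintype.sum_sum_type, Finset.sum_filter, Finset.sum_filter]
  rfl

/-- The net local power balance at a bus is minus the sum of `sTilde` over its units. -/
lemma sum_injection (P : PowerSystem N G L) (a : P.State) (j : N) :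
    ∑ k with P.busG k = j, P.pM a k - ∑ k with P.busL k = j, P.dc a k
      - ∑ k with P.bus k = j, P.pL k = -∑ k with P.bus k = j, P.sTilde a k := by
  rw [sum_units_at, sum_units_at]
  have hG : ∀ k, P.sTilde a (Sum.inl k) = -P.pM a k + P.pL (Sum.inl k) := fun _ => rfl
  have hL : ∀ k, P.sTilde a (Sum.inr k) = P.dc a k + P.pL (Sum.inr k) := fun _ => rfl
  simp only [hG, hL, Finset.sum_add_distrib, Finset.sum_neg_distrib]
  ring

lemma sum_bus_fiber (P : PowerSystem N G L) (F : G ⊕ L → ℝ) :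
    ∑ j, ∑ k with P.bus k = j, F k = ∑ k, F k :=
  Finset.sum_fiberwise _ _ _

lemma numUnits_bus_pos (P : PowerSystem N G L) (k : G ⊕ L) : 0 < P.numUnits (P.bus k) :=
  Finset.card_pos.2 ⟨k, by simp⟩

/-- Splitting the quantity `c j` evenly among the units of bus `j` loses only the contribution of
the buses without units. -/
lemma sum_div_numUnits_le (P : PowerSystem N G L) {c : N → ℝ} (hc : ∀ j, 0 ≤ c j) :
    ∑ k, c (P.bus k) / P.numUnits (P.bus k) ≤ ∑ j, c j := by
  rw [← P.sum_bus_fiber]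
  refine Finset.sum_le_sum fun j _ => ?_
  have h : ∑ k with P.bus k = j, c (P.bus k) / P.numUnits (P.bus k)
      = ∑ k with P.bus k = j, c j / P.numUnits j :=
    Finset.sum_congr rfl fun k hk => by rw [(Finset.mem_filter.1 hk).2]
  rw [h, Finset.sum_const, nsmul_eq_mul, ← mul_div_assoc, mul_comm, mul_div_assoc]
  exact mul_le_of_le_one_right (hc j) (div_self_le_one _)

/-- The determinant condition contained in the matrix inequality. -/
lemma DesignLMI.sq_le {P : PowerSystem N G L} {β βhat : G ⊕ L → ℝ} (h : P.DesignLMI β βhat)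
    (k : G ⊕ L) : (P.h k + β k / 2) ^ 2 ≤
      (P.h k + P.D (P.bus k) / P.numUnits (P.bus k)) * (P.h k - βhat k / 2) := by
  have h2 := (h k).det_nonneg
  rw [Matrix.det_fin_two] at h2
  simp only [Matrix.neg_apply, Matrix.of_apply, Matrix.cons_val', Matrix.cons_val_zero,
    Matrix.cons_val_one, Matrix.cons_val_fin_one] at h2
  linarith

lemma D_div_numUnits_pos (P : PowerSystem N G L) (k : G ⊕ L) :
    0 < P.D (P.bus k) / P.numUnits (P.bus k) :=
  div_pos (P.D_pos _) (by exact_mod_cast P.numUnits_bus_pos k)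

/-- The bound on the signal gain is smaller than the share of the bus damping that belongs to the
unit. -/
lemma DesignLMI.lt {P : PowerSystem N G L} {β βhat : G ⊕ L → ℝ} (h : P.DesignLMI β βhat)
    (hβhat : ∀ k, 0 < βhat k) (k : G ⊕ L) :
    β k < P.D (P.bus k) / P.numUnits (P.bus k) := by
  have h2 := h.sq_le k
  have hk := P.h_pos k
  have hD := P.D_div_numUnits_pos k
  set D := P.D (P.bus k) / P.numUnits (P.bus k)
  have h3 : 0 < (P.h k + D) * (βhat k / 2) := mul_pos (by linarith) (by linarith [hβhat k])
  have h4 : P.h k * β k < P.h k * D := by nlinarith [sq_nonneg (β k)]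
  exact lt_of_mul_lt_mul_left h4 hk.le

lemma H_eq_incidence (P : PowerSystem N G L) : P.H = incidence P.links := rfl

/-- At an equilibrium all frequencies equal a common `c`, and summing the swing and the command
equations gives `(∑ D) c = ∑ n`, where `|∑ n| ≤ (∑ β) |c|` and `∑ β < ∑ D`. -/
lemma omega_eq_zero_of_mem_equilibria (P : PowerSystem N G L) {β βhat : G ⊕ L → ℝ}
    (hβhat : ∀ k, 0 < βhat k) (hLMI : P.DesignLMI β βhat) {a : P.State}
    (ha : a ∈ P.equilibria β) : P.ω a = 0 := by
  obtain ⟨n, hn, hd⟩ := ha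
  have : Nonempty (G ⊕ L) := P.links_connected.nonempty
  have hω : ∀ i j, P.ω a i = P.ω a j := eq_of_connected P.lines_connected fun e => by
    have h := hd.angle e
    exact (sub_eq_zero.1 h.symm)
  obtain ⟨j₀⟩ := P.lines_connected.nonempty
  set c := P.ω a j₀ with hc
  have hs : ∑ k, P.sTilde a k + ∑ k, n k = 0 := by
    have h := Finset.sum_congr rfl fun k (_ : k ∈ Finset.univ) => hd.command k
    simp only [Finset.sum_add_distrib, Finset.sum_sub_distrib, H_eq_incidence,
      sum_incidence_mulVec, sub_zero] at h
    rw [← h]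
    exact Finset.sum_eq_zero fun k _ => mul_zero _
  have hsw : (∑ j, P.D j) * c = ∑ k, n k := by
    have h : ∀ j, P.D j * c =
        -∑ k with P.bus k = j, P.sTilde a k - (incidence P.lines).mulVec (P.p a) j := fun j => by
      have h1 := hd.swing j
      rw [P.sum_injection, hω j j₀] at h1
      rw [incidence_mulVec]
      have h2 : P.M j * P.ω (0 : P.State) j = 0 := mul_zero _
      rw [h2] at h1
      linarith
    rw [Finset.sum_mul, Finset.sum_congr rfl fun j _ => h j, Finset.sum_sub_distrib,
      Finset.sum_neg_distrib, P.sum_bus_fiber, sum_incidence_mulVec]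
    linarith
  have hβD : ∑ k, β k < ∑ j, P.D j :=
    (Finset.sum_lt_sum_of_nonempty Finset.univ_nonempty fun k _ => hLMI.lt hβhat k).trans_le
      (P.sum_div_numUnits_le fun j => (P.D_pos j).le)
  have hle : (∑ j, P.D j) * |c| ≤ (∑ k, β k) * |c| := by
    have h1 : |∑ j, P.D j| = ∑ j, P.D j :=
      abs_of_nonneg (Finset.sum_nonneg fun j _ => (P.D_pos j).le)
    rw [← h1, ← abs_mul, hsw, Finset.sum_mul]
    refine (Finset.abs_sum_le_sum_abs _ _).trans (Finset.sum_le_sum fun k _ => ?_)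
    have h2 := hn k
    rwa [hω (P.bus k) j₀] at h2
  have hc0 : c = 0 := by
    by_contra h
    exact absurd (le_of_mul_le_mul_right hle (abs_pos.2 h)) (not_le.2 hβD)
  ext j
  rw [hω j j₀, ← hc, hc0, Pi.zero_apply]

/-- There is an equilibrium with zero frequency deviation, and it may be chosen such that the
deviations of `η` and of `ψ` from given values are orthogonal to the circulations
(for `ψ` with the weights `γ'`). These orthogonality relations are conserved along solutions. -/
lemma exists_equilibrium (P : PowerSystem N G L) (a₀ : P.State) :
    ∃ a : P.State, P.Dynamics 0 a 0 ∧ P.ω a = 0 ∧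
      (∀ y, (incidence P.lines).mulVec y = 0 → ∑ e, y e * P.η (a₀ - a) e = 0) ∧
      (∀ y, P.H.mulVec y = 0 → ∑ e, P.γ' e * y e * P.ψ (a₀ - a) e = 0) := by
  have : Nonempty (G ⊕ L) := P.links_connected.nonempty
  let r : G ⊕ L → ℝ := fun k => Sum.elim (fun g => P.m g) (fun _ => 0) k + P.h k
  have hr : 0 < ∑ k, r k := Finset.sum_pos (fun k _ => by
    rcases k with g | l
    · exact add_pos (P.m_pos g) (P.h_pos _)
    · exact add_pos_of_nonneg_of_pos le_rfl (P.h_pos _)) Finset.univ_nonempty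
  -- the common power command that balances total demand
  let c : ℝ := (∑ k, P.pL k) / ∑ k, r k
  let s : G ⊕ L → ℝ := fun k => -(r k * c) + P.pL k
  have hs : ∑ k, s k = 0 := by
    simp only [s, Finset.sum_add_distrib, Finset.sum_neg_distrib, ← Finset.sum_mul, c]
    field_simp
    ring
  obtain ⟨ψ, hψ, hψ'⟩ := exists_flow P.links_connected P.γ'_pos hs (P.ψ a₀)
  obtain ⟨z, hz, hz'⟩ := exists_flow P.lines_connected (w := fun e => (P.B e)⁻¹)
    (s := fun j => -∑ k with P.bus k = j, s k) (fun e => inv_pos.2 (P.B_pos e))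
    (by rw [Finset.sum_neg_distrib, P.sum_bus_fiber, hs, neg_zero]) (fun e => P.B e * P.η a₀ e)
  let a : P.State := (fun e => z e / P.B e, ψ, 0, fun g => P.m g * c, fun _ => c)
  have hsT : ∀ k, P.sTilde a k = s k := by
    rintro (g | l)
    · change -(P.m g * c + P.h (Sum.inl g) * (c - 0)) + P.pL _ =
        -((P.m g + P.h (Sum.inl g)) * c) + P.pL _
      ring
    · change -(P.h (Sum.inr l) * (c - 0)) + P.pL _ =
        -((0 + P.h (Sum.inr l)) * c) + P.pL _
      ring
  have hp : P.p a = z := funext fun e => mul_div_cancel₀ _ (P.B_pos e).ne'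
  refine ⟨a, ⟨fun e => ?_, fun j => ?_, fun k => ?_, fun e => ?_, fun k => ?_⟩, rfl,
    fun y hy => ?_, fun y hy => hψ' y hy⟩
  · change (0 : ℝ) = 0 - 0
    ring
  · have h := congrFun hz j
    rw [incidence_mulVec] at h
    rw [P.sum_injection, Finset.sum_congr rfl fun k _ => hsT k, hp]
    change P.M j * 0 = _ - P.D j * 0 - _ + _
    linarith
  · change P.τ k * 0 = -(P.m k * c) + P.m k * (c - 0)
    ring
  · rw [H_eq_incidence, incidence_transpose_mulVec]
    change P.γ' e * 0 = c - c
    ring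
  · rw [hsT, H_eq_incidence]
    change P.γ k * 0 = s k - (incidence P.links).mulVec ψ k + 0
    rw [hψ]
    ring
  · rw [← hz' y hy]
    refine Finset.sum_congr rfl fun e _ => ?_
    have := (P.B_pos e).ne'
    change y e * (P.η a₀ e - z e / P.B e) = _
    field_simp

end PowerSystem

/-! ### Dissipation of a single unit -/

/-- The dissipation inequality of a single active unit, with frequency `w`, power command error
`p`, internal state `x` and privacy signal `ν`. The matrix inequality bounds the dissipation from
below only by `(A |w| - b |p|)² / A`, which degenerates in one direction; the term with `δ`, which
comes from counting the energy of the physical network slightly more than once, controls `w`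
itself. -/
lemma unit_dissipation {h D β d m : ℝ} (hh : 0 < h) (hD : 0 < D) (hβ : 0 < β) (hm : 0 < m)
    (hLMI : (h + β / 2) ^ 2 ≤ (h + D) * d) :
    ∃ δ₀ > 0, ∀ δ, 0 < δ → δ ≤ δ₀ → ∃ κ > 0, ∀ w p x ν : ℝ, |ν| ≤ β * |w| →
      δ * w * (h * (p - w) + x) - h * (p - w) ^ 2 + p * ν + (h - d) * p ^ 2 - x ^ 2 / m
        - (1 + δ) * D * w ^ 2 ≤ -κ * (D * w ^ 2 + p ^ 2 + x ^ 2) := by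
  set A := h + D with hA
  set b := h + β / 2 with hb
  have hA0 : 0 < A := by positivity
  have hb0 : 0 < b := by positivity
  have hhb : h < b := by linarith
  set c := A * (1 - h / b) with hc
  have hc0 : 0 < c := mul_pos hA0 (by rw [sub_pos, div_lt_one hb0]; exact hhb)
  refine ⟨min (c / (2 * A)) (c / (2 * m)), by positivity, fun δ hδ hδ' => ?_⟩
  have hδA : δ / c ≤ 1 / (2 * A) := by
    have := hδ'.trans (min_le_left _ _)
    rw [div_le_iff₀ hc0]; rw [one_div_mul_eq_div]; exact this
  have hδm : δ / c ≤ 1 / (2 * m) := by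
    have := hδ'.trans (min_le_right _ _)
    rw [div_le_iff₀ hc0]; rw [one_div_mul_eq_div]; exact this
  have hE0 : 0 < D + 2 * A ^ 2 / b ^ 2 := by positivity
  set κ := min (1 / (2 * m)) (min (b ^ 2 / (4 * A)) (δ * c / 2 / (D + 2 * A ^ 2 / b ^ 2))) with hκ
  have hκ0 : 0 < κ := by positivity
  have hκ1 : κ ≤ 1 / (2 * m) := min_le_left _ _
  have hκ2 : κ * (2 / b ^ 2) ≤ 1 / (2 * A) := by
    have h1 : κ ≤ b ^ 2 / (4 * A) := (min_le_right _ _).trans (min_le_left _ _)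
    calc κ * (2 / b ^ 2) ≤ b ^ 2 / (4 * A) * (2 / b ^ 2) := by gcongr
      _ = 1 / (2 * A) := by field_simp; norm_num
  have hκ3 : κ * (D + 2 * A ^ 2 / b ^ 2) ≤ δ * c / 2 := by
    rw [← le_div_iff₀ hE0]
    exact (min_le_right _ _).trans (min_le_right _ _)
  refine ⟨κ, hκ0, fun w p x ν hν => ?_⟩
  have ht := abs_nonneg w
  have hr := abs_nonneg p
  have h1 : p * ν ≤ |p| * (β * |w|) := by
    calc p * ν ≤ |p| * |ν| := by rw [← abs_mul]; exact le_abs_self _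
      _ ≤ _ := by gcongr
  have h2 : w * p ≤ |w| * |p| := by rw [← abs_mul]; exact le_abs_self _
  have h3 : w * x ≤ |w| * |x| := by rw [← abs_mul]; exact le_abs_self _
  rw [← sq_abs w, ← sq_abs p, ← sq_abs x]
  have hL : δ * w * (h * (p - w) + x) - h * (p - w) ^ 2 + p * ν + (h - d) * |p| ^ 2 - |x| ^ 2 / m
        - (1 + δ) * D * |w| ^ 2 = -A * |w| ^ 2 - d * |p| ^ 2 + 2 * h * (w * p) + p * ν - |x| ^ 2 / m
          + δ * (h * (w * p) - A * |w| ^ 2 + w * x) := by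
    rw [sq_abs, sq_abs, sq_abs, hA]; ring
  rw [hL]
  generalize |w| = t at *
  generalize |p| = r at *
  generalize |x| = X at *
  have h4 : 2 * h * (w * p) ≤ 2 * h * (t * r) := by gcongr
  have h5 : δ * (h * (w * p) - A * t ^ 2 + w * x) ≤ δ * (h * (t * r) - A * t ^ 2 + t * X) := by
    gcongr
  -- the component of `(t, r)` along which the quadratic form of the matrix inequality is definite
  set z := b * r - A * t with hz
  have hr' : r = (z + A * t) / b := by rw [hz]; field_simp; ring
  have h6 : b ^ 2 / A * r ^ 2 ≤ d * r ^ 2 := by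
    gcongr
    rw [div_le_iff₀ hA0]; linarith
  have h7 : -A * t ^ 2 - b ^ 2 / A * r ^ 2 + 2 * b * (t * r) = -(z ^ 2 / A) := by
    rw [hz]; field_simp; ring
  have h8 : h * (t * r) - A * t ^ 2 = h / b * (t * z) - c * t ^ 2 := by
    rw [hr', hc]; field_simp; ring
  have h9 : h / b * (t * z) ≤ c / 4 * t ^ 2 + z ^ 2 / c := by
    calc h / b * (t * z) ≤ h / b * |t * z| := by gcongr; exact le_abs_self _
      _ ≤ 1 * |t * z| := by gcongr; exact (div_lt_one hb0).2 hhb |>.le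
      _ = t * |z| := by rw [one_mul, abs_mul, abs_of_nonneg ht]
      _ ≤ c / 4 * t ^ 2 + |z| ^ 2 / c := by
        have : 0 ≤ (c / 2 * t - |z|) ^ 2 / c := by positivity
        have h' : (c / 2 * t - |z|) ^ 2 / c = c / 4 * t ^ 2 + |z| ^ 2 / c - t * |z| := by
          field_simp; ring
        linarith
      _ = _ := by rw [sq_abs]
  have h10 : t * X ≤ c / 4 * t ^ 2 + X ^ 2 / c := by
    have : 0 ≤ (c / 2 * t - X) ^ 2 / c := by positivity
    have h' : (c / 2 * t - X) ^ 2 / c = c / 4 * t ^ 2 + X ^ 2 / c - t * X := by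
      field_simp; ring
    linarith
  have h11 : δ * (h * (t * r) - A * t ^ 2 + t * X) ≤
      δ * (-(c / 2) * t ^ 2 + z ^ 2 / c + X ^ 2 / c) := by
    refine mul_le_mul_of_nonneg_left ?_ hδ.le
    rw [h8]; linarith
  have h12 : δ * (z ^ 2 / c) ≤ 1 / (2 * A) * z ^ 2 := by
    rw [← mul_comm_div]; gcongr
  have h13 : δ * (X ^ 2 / c) ≤ 1 / (2 * m) * X ^ 2 := by
    rw [← mul_comm_div]; gcongr
  have h14 : z ^ 2 / A = 1 / (2 * A) * z ^ 2 + 1 / (2 * A) * z ^ 2 := by field_simp; norm_num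
  have h15 : X ^ 2 / m = 1 / (2 * m) * X ^ 2 + 1 / (2 * m) * X ^ 2 := by field_simp; norm_num
  have h16 : κ * r ^ 2 ≤ κ * (2 / b ^ 2) * z ^ 2 + κ * (2 * A ^ 2 / b ^ 2) * t ^ 2 := by
    have h' : r ^ 2 ≤ 2 / b ^ 2 * z ^ 2 + 2 * A ^ 2 / b ^ 2 * t ^ 2 := by
      have h'' : 2 / b ^ 2 * z ^ 2 + 2 * A ^ 2 / b ^ 2 * t ^ 2 - r ^ 2
          = ((z - A * t) / b) ^ 2 := by
        rw [hr']; field_simp; ring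
      linarith [sq_nonneg ((z - A * t) / b)]
    calc κ * r ^ 2 ≤ κ * (2 / b ^ 2 * z ^ 2 + 2 * A ^ 2 / b ^ 2 * t ^ 2) := by gcongr
      _ = _ := by ring
  have h17 : κ * (2 / b ^ 2) * z ^ 2 ≤ 1 / (2 * A) * z ^ 2 := by gcongr
  have h18 : κ * (D + 2 * A ^ 2 / b ^ 2) * t ^ 2 ≤ δ * c / 2 * t ^ 2 := by gcongr
  have h19 : κ * X ^ 2 ≤ 1 / (2 * m) * X ^ 2 := by gcongr
  have h20 : r * (β * t) + 2 * h * (t * r) = 2 * b * (t * r) := by rw [hb]; ring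
  have h21 : δ * (-(c / 2) * t ^ 2 + z ^ 2 / c + X ^ 2 / c)
      = -(δ * c / 2 * t ^ 2) + δ * (z ^ 2 / c) + δ * (X ^ 2 / c) := by ring
  have h22 : κ * (D + 2 * A ^ 2 / b ^ 2) * t ^ 2
      = κ * D * t ^ 2 + κ * (2 * A ^ 2 / b ^ 2) * t ^ 2 := by ring
  have h23 : -κ * (D * t ^ 2 + r ^ 2 + X ^ 2) = -(κ * D * t ^ 2) - κ * r ^ 2 - κ * X ^ 2 := by ring
  linarith

/-! ### Finite sums of squares -/

lemma exists_pos_le_all {ι : Type*} [Finite ι] {f : ι → ℝ} (hf : ∀ i, 0 < f i) :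
    ∃ c > 0, ∀ i, c ≤ f i := by
  rcases isEmpty_or_nonempty ι with h | h
  · exact ⟨1, one_pos, fun i => (h.false i).elim⟩
  · obtain ⟨i, hi⟩ := Finite.exists_min f
    exact ⟨f i, hf i, hi⟩

lemma exists_pos_all_le {ι : Type*} [Finite ι] (f : ι → ℝ) : ∃ C > 0, ∀ i, f i ≤ C := by
  rcases isEmpty_or_nonempty ι with h | h
  · exact ⟨1, one_pos, fun i => (h.false i).elim⟩
  · obtain ⟨i, hi⟩ := Finite.exists_max f
    exact ⟨max (f i) 1, by positivity, fun j => (hi j).trans (le_max_left _ _)⟩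

lemma exists_pos_mul_sum_sq_le {ι : Type*} [Fintype ι] {w : ι → ℝ} (hw : ∀ i, 0 < w i) :
    ∃ c > 0, ∀ z : ι → ℝ, c * ∑ i, z i ^ 2 ≤ ∑ i, w i * z i ^ 2 := by
  obtain ⟨c, hc, h⟩ := exists_pos_le_all hw
  refine ⟨c, hc, fun z => ?_⟩
  rw [Finset.mul_sum]
  exact Finset.sum_le_sum fun i _ => mul_le_mul_of_nonneg_right (h i) (sq_nonneg _)

lemma exists_sum_mul_sq_le {ι : Type*} [Fintype ι] (w : ι → ℝ) :
    ∃ C > 0, ∀ z : ι → ℝ, ∑ i, w i * z i ^ 2 ≤ C * ∑ i, z i ^ 2 := by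
  obtain ⟨C, hC, h⟩ := exists_pos_all_le w
  refine ⟨C, hC, fun z => ?_⟩
  rw [Finset.mul_sum]
  exact Finset.sum_le_sum fun i _ => mul_le_mul_of_nonneg_right (h i) (sq_nonneg _)

lemma sum_mulVec_sq_le {m n : Type*} [Fintype m] [Fintype n] (A : Matrix m n ℝ) (z : n → ℝ) :
    ∑ i, A.mulVec z i ^ 2 ≤ (∑ i, ∑ j, A i j ^ 2) * ∑ j, z j ^ 2 := by
  rw [Finset.sum_mul]
  exact Finset.sum_le_sum fun i _ => Finset.sum_mul_sq_le_sq_mul_sq _ _ _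

lemma abs_mulVec_le {m n : Type*} [Fintype n] (A : Matrix m n ℝ) {z w : n → ℝ} {s : ℝ}
    (h : ∀ j, |z j| ≤ w j * s) (i : m) : |A.mulVec z i| ≤ (∑ j, |A i j| * w j) * s := by
  rw [Finset.sum_mul]
  refine (Finset.abs_sum_le_sum_abs _ _).trans (Finset.sum_le_sum fun j _ => ?_)
  rw [abs_mul, mul_assoc]
  exact mul_le_mul_of_nonneg_left (h j) (abs_nonneg _)

/-! ### Error dynamics and power balance -/

namespace PowerSystem

variable {N G L : Type*} [Fintype N] [Fintype G] [Fintype L]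
  [DecidableEq N] [DecidableEq G] [DecidableEq L]

/-- The deviation of the output of a unit, generation counted positively and demand negatively,
at the deviation `b` of the state from an equilibrium. -/
def output (P : PowerSystem N G L) (b : P.State) (k : G ⊕ L) : ℝ :=
  P.h k * (P.pc b k - P.ω b (P.bus k)) + Sum.elim (P.x b) 0 k

/-- The dynamics of the deviation `b` from an equilibrium. The part `-ξ * ṗᶜ` of the privacy signal
is moved to the left-hand side of the command equation, where it acts as additional inertia; `f` is
the remaining part of the signal. -/
structure ErrorDynamics (P : PowerSystem N G L) (ξ f : G ⊕ L → ℝ) (b b' : P.State) : Prop where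
  angle : ∀ e : P.lines, P.η b' e = P.ω b e.1.1 - P.ω b e.1.2
  swing : ∀ j : N, P.M j * P.ω b' j =
    ∑ k with P.bus k = j, P.output b k - P.D j * P.ω b j - (incidence P.lines).mulVec (P.p b) j
  generation : ∀ k : G, P.τ k * P.x b' k =
    -P.x b k + P.m k * (P.pc b (Sum.inl k) - P.ω b (P.busG k))
  link : ∀ e : P.links, P.γ' e * P.ψ b' e = P.pc b e.1.1 - P.pc b e.1.2
  command : ∀ k : G ⊕ L, (P.γ k + ξ k) * P.pc b' k =
    -P.output b k - P.H.mulVec (P.ψ b) k + f k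

lemma sTilde_sub (P : PowerSystem N G L) (a a₀ : P.State) (k : G ⊕ L) :
    P.sTilde a k - P.sTilde a₀ k = -P.output (a - a₀) k := by
  rcases k with g | l
  · change (-(P.x a g + P.h (Sum.inl g) * (P.pc a (Sum.inl g) - P.ω a (P.busG g))) + _) -
      (-(P.x a₀ g + P.h (Sum.inl g) * (P.pc a₀ (Sum.inl g) - P.ω a₀ (P.busG g))) + _) =
      -(P.h (Sum.inl g) * (P.pc a (Sum.inl g) - P.pc a₀ (Sum.inl g)
        - (P.ω a (P.busG g) - P.ω a₀ (P.busG g))) + (P.x a g - P.x a₀ g))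
    ring
  · change (-(P.h (Sum.inr l) * (P.pc a (Sum.inr l) - P.ω a (P.busL l))) + _) -
      (-(P.h (Sum.inr l) * (P.pc a₀ (Sum.inr l) - P.ω a₀ (P.busL l))) + _) =
      -(P.h (Sum.inr l) * (P.pc a (Sum.inr l) - P.pc a₀ (Sum.inr l)
        - (P.ω a (P.busL l) - P.ω a₀ (P.busL l))) + 0)
    ring

lemma Dynamics.error {P : PowerSystem N G L} {n ξ f : G ⊕ L → ℝ} {a a' a₀ : P.State}
    (h : P.Dynamics n a a') (h₀ : P.Dynamics 0 a₀ 0)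
    (hn : ∀ k, n k = -ξ k * P.pc a' k + f k) : P.ErrorDynamics ξ f (a - a₀) a' := by
  refine ⟨fun e => ?_, fun j => ?_, fun k => ?_, fun e => ?_, fun k => ?_⟩
  · have h1 := h.angle e
    have h2 := h₀.angle e
    change (0 : ℝ) = _ at h2
    change _ = (P.ω a e.1.1 - P.ω a₀ e.1.1) - (P.ω a e.1.2 - P.ω a₀ e.1.2)
    linarith
  · have h1 := h.swing j
    have h2 := h₀.swing j
    change P.M j * 0 = _ at h2
    rw [sum_injection] at h1 h2
    have h3 : P.p (a - a₀) = P.p a - P.p a₀ := funext fun e => mul_sub _ _ _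
    have h4 : ∑ k with P.bus k = j, P.output (a - a₀) k =
        -(∑ k with P.bus k = j, P.sTilde a k - ∑ k with P.bus k = j, P.sTilde a₀ k) := by
      rw [← Finset.sum_sub_distrib, ← Finset.sum_neg_distrib]
      exact Finset.sum_congr rfl fun k _ => by rw [sTilde_sub, neg_neg]
    rw [h4, h3, Matrix.mulVec_sub, Pi.sub_apply, incidence_mulVec, incidence_mulVec]
    change _ = _ - P.D j * (P.ω a j - P.ω a₀ j) - _
    linarith
  · have h1 := h.generation k
    have h2 := h₀.generation k
    change P.τ k * 0 = _ at h2
    change _ = -(P.x a k - P.x a₀ k) + P.m k * ((P.pc a (Sum.inl k) - P.pc a₀ (Sum.inl k)) -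
      (P.ω a (P.busG k) - P.ω a₀ (P.busG k)))
    unfold u at h1 h2
    linarith
  · have h1 := h.link e
    have h2 := h₀.link e
    rw [H_eq_incidence, incidence_transpose_mulVec] at h1 h2
    change P.γ' e * 0 = _ at h2
    change _ = (P.pc a e.1.1 - P.pc a₀ e.1.1) - (P.pc a e.1.2 - P.pc a₀ e.1.2)
    linarith
  · have h1 := h.command k
    have h2 := h₀.command k
    have h3 := P.sTilde_sub a a₀ k
    change P.γ k * 0 = _ + 0 at h2
    have h4 : P.ψ (a - a₀) = P.ψ a - P.ψ a₀ := rfl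
    rw [h4, Matrix.mulVec_sub, Pi.sub_apply, ← h3]
    rw [hn k] at h1
    linarith

/-- The storage function: the energy of the physical network (counted `1 + δ` times) plus the
energies of the controller and of the generation units. The privacy signal enters through the
time-varying inertia `γ + ξ` of the power command. -/
def energy (P : PowerSystem N G L) (δ : ℝ) (ξ : G ⊕ L → ℝ) (b : P.State) : ℝ :=
  ((1 + δ) * (∑ j, P.M j * P.ω b j ^ 2 + ∑ e, P.B e * P.η b e ^ 2) + ∑ e, P.γ' e * P.ψ b e ^ 2
    + ∑ k, (P.γ k + ξ k) * P.pc b k ^ 2 + ∑ k, P.τ k / P.m k * P.x b k ^ 2) / 2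

/-- The time derivative of `energy` when `b` and `ξ` have time derivatives `b'` and `ξ'`. -/
def energyDeriv (P : PowerSystem N G L) (δ : ℝ) (ξ ξ' : G ⊕ L → ℝ) (b b' : P.State) : ℝ :=
  (1 + δ) * (∑ j, P.M j * (P.ω b j * P.ω b' j) + ∑ e, P.B e * (P.η b e * P.η b' e))
    + ∑ e, P.γ' e * (P.ψ b e * P.ψ b' e)
    + ∑ k, ((P.γ k + ξ k) * (P.pc b k * P.pc b' k) + ξ' k / 2 * P.pc b k ^ 2)
    + ∑ k, P.τ k / P.m k * (P.x b k * P.x b' k)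

/-- The products of the velocities `ω`, `pᶜ` with the forces that drive them. Along solutions, this
detects nonzero forces at times when the velocities vanish. -/
def cross (P : PowerSystem N G L) (b : P.State) : ℝ :=
  ∑ j, P.M j * (P.ω b j * (incidence P.lines).mulVec (P.p b) j)
    + ∑ k, P.pc b k * P.H.mulVec (P.ψ b) k

/-- The time derivative of `cross` when `b` has time derivative `b'`. -/
def crossDeriv (P : PowerSystem N G L) (b b' : P.State) : ℝ :=
  ∑ j, P.M j * (P.ω b' j * (incidence P.lines).mulVec (P.p b) j
      + P.ω b j * (incidence P.lines).mulVec (P.p b') j)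
    + ∑ k, (P.pc b' k * P.H.mulVec (P.ψ b) k + P.pc b k * P.H.mulVec (P.ψ b') k)

/-- The sum of the squares of the coordinates that are dissipated directly. -/
def damped (P : PowerSystem N G L) (b : P.State) : ℝ :=
  ∑ j, P.ω b j ^ 2 + ∑ k, P.pc b k ^ 2 + ∑ k, P.x b k ^ 2

/-- The sum of the squares of the line and link forces at `b`, the latter divided by the
inertias `γ + ξ`. -/
def force (P : PowerSystem N G L) (ξ : G ⊕ L → ℝ) (b : P.State) : ℝ :=
  ∑ j, (incidence P.lines).mulVec (P.p b) j ^ 2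
    + ∑ k, P.H.mulVec (P.ψ b) k ^ 2 / (P.γ k + ξ k)

/-- The power balance: the network and the links are lossless, so that the energy changes only
through the units and through the damping at the buses. -/
lemma ErrorDynamics.energyDeriv_eq {P : PowerSystem N G L} {ξ f : G ⊕ L → ℝ} {b b' : P.State}
    (h : P.ErrorDynamics ξ f b b') (δ : ℝ) (ξ' : G ⊕ L → ℝ) :
    P.energyDeriv δ ξ ξ' b b' =
      ∑ k, (δ * P.ω b (P.bus k) * (P.h k * (P.pc b k - P.ω b (P.bus k)) + Sum.elim (P.x b) 0 k)
        - P.h k * (P.pc b k - P.ω b (P.bus k)) ^ 2 + P.pc b k * f k + ξ' k / 2 * P.pc b k ^ 2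
        - Sum.elim (P.x b) 0 k ^ 2 / Sum.elim P.m 1 k)
      - (1 + δ) * ∑ j, P.D j * P.ω b j ^ 2 := by
  have h1 : ∑ j, P.M j * (P.ω b j * P.ω b' j) = ∑ k, P.output b k * P.ω b (P.bus k)
      - ∑ j, P.D j * P.ω b j ^ 2 - ∑ j, (incidence P.lines).mulVec (P.p b) j * P.ω b j := by
    rw [← P.sum_bus_fiber, ← Finset.sum_sub_distrib, ← Finset.sum_sub_distrib]
    refine Finset.sum_congr rfl fun j _ => ?_
    have h2 : ∑ k with P.bus k = j, P.output b k * P.ω b (P.bus k)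
        = (∑ k with P.bus k = j, P.output b k) * P.ω b j := by
      rw [Finset.sum_mul]
      exact Finset.sum_congr rfl fun k hk => by rw [(Finset.mem_filter.1 hk).2]
    rw [h2, mul_left_comm, h.swing j]
    ring
  have h2 : ∑ e, P.B e * (P.η b e * P.η b' e)
      = ∑ j, (incidence P.lines).mulVec (P.p b) j * P.ω b j := by
    rw [sum_incidence_mulVec_mul]
    refine Finset.sum_congr rfl fun e _ => ?_
    rw [h.angle e, ← mul_assoc]
    rfl
  have h3 : ∑ e, P.γ' e * (P.ψ b e * P.ψ b' e) = ∑ k, P.H.mulVec (P.ψ b) k * P.pc b k := by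
    rw [H_eq_incidence, sum_incidence_mulVec_mul]
    refine Finset.sum_congr rfl fun e _ => ?_
    rw [mul_left_comm, h.link e]
  have h4 : ∑ k, P.τ k / P.m k * (P.x b k * P.x b' k) =
      ∑ k : G ⊕ L, (-(Sum.elim (P.x b) 0 k ^ 2 / Sum.elim P.m 1 k)
        + Sum.elim (P.x b) 0 k * (P.pc b k - P.ω b (P.bus k))) := by
    rw [Fintype.sum_sum_type]
    have h5 : ∑ l : L, (-(Sum.elim (P.x b) (0 : L → ℝ) (Sum.inr l) ^ 2
        / Sum.elim P.m (1 : L → ℝ) (Sum.inr l))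
        + Sum.elim (P.x b) (0 : L → ℝ) (Sum.inr l) *
          (P.pc b (Sum.inr l) - P.ω b (P.bus (Sum.inr l)))) = 0 :=
      Finset.sum_eq_zero fun l _ => by simp
    rw [h5, add_zero]
    refine Finset.sum_congr rfl fun g _ => ?_
    have h6 := P.m_pos g
    have h7 : P.τ g / P.m g * (P.x b g * P.x b' g) = P.x b g * (P.τ g * P.x b' g) / P.m g := by
      ring
    rw [h7, h.generation g]
    change _ = -(P.x b g ^ 2 / P.m g) + P.x b g * (P.pc b (Sum.inl g) - P.ω b (P.busG g))
    field_simp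
  have h5 : ∑ k, ((P.γ k + ξ k) * (P.pc b k * P.pc b' k) + ξ' k / 2 * P.pc b k ^ 2) =
      ∑ k, (P.pc b k * (-P.output b k + f k) + ξ' k / 2 * P.pc b k ^ 2)
        - ∑ k, P.H.mulVec (P.ψ b) k * P.pc b k := by
    rw [← Finset.sum_sub_distrib]
    refine Finset.sum_congr rfl fun k _ => ?_
    rw [mul_left_comm, h.command k]
    ring
  have h6 : (1 + δ) * ∑ k, P.output b k * P.ω b (P.bus k)
      + ∑ k, (P.pc b k * (-P.output b k + f k) + ξ' k / 2 * P.pc b k ^ 2)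
      + ∑ k : G ⊕ L, (-(Sum.elim (P.x b) 0 k ^ 2 / Sum.elim P.m 1 k)
        + Sum.elim (P.x b) 0 k * (P.pc b k - P.ω b (P.bus k))) =
      ∑ k, (δ * P.ω b (P.bus k) * (P.h k * (P.pc b k - P.ω b (P.bus k)) + Sum.elim (P.x b) 0 k)
        - P.h k * (P.pc b k - P.ω b (P.bus k)) ^ 2 + P.pc b k * f k + ξ' k / 2 * P.pc b k ^ 2
        - Sum.elim (P.x b) 0 k ^ 2 / Sum.elim P.m 1 k) := by
    rw [Finset.mul_sum, ← Finset.sum_add_distrib, ← Finset.sum_add_distrib]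
    refine Finset.sum_congr rfl fun k _ => ?_
    unfold output
    ring
  unfold energyDeriv
  rw [h1, h2, h3, h4, h5, ← h6]
  ring

/-- For a suitable weight `1 + δ` of the physical energy, the dissipation is definite in
`(ω, pᶜ, x)`. -/
lemma exists_energyDeriv_le (P : PowerSystem N G L) {β βhat : G ⊕ L → ℝ} (hβ : ∀ k, 0 < β k)
    (hLMI : P.DesignLMI β βhat) :
    ∃ δ > 0, ∃ κ > 0, ∀ (ξ ξ' f : G ⊕ L → ℝ) (b b' : P.State), P.ErrorDynamics ξ f b b' →
      (∀ k, |f k| ≤ β k * |P.ω b (P.bus k)|) → (∀ k, ξ' k ≤ βhat k) →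
      P.energyDeriv δ ξ ξ' b b' ≤ -κ * P.damped b := by
  have hm : ∀ k : G ⊕ L, 0 < Sum.elim P.m 1 k := by
    rintro (g | l)
    · exact P.m_pos g
    · exact one_pos
  choose δ₀ hδ₀ hunit using fun k => unit_dissipation (P.h_pos k) (P.D_div_numUnits_pos k) (hβ k)
    (hm k) (hLMI.sq_le k)
  obtain ⟨δ, hδ, hδ'⟩ := exists_pos_le_all hδ₀
  choose κ₀ hκ₀ hunit using fun k => hunit k δ hδ (hδ' k)
  obtain ⟨κ₁, hκ₁, hκ₁'⟩ := exists_pos_le_all hκ₀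
  obtain ⟨κ₂, hκ₂, hκ₂'⟩ := exists_pos_mul_sum_sq_le P.D_pos
  -- `κ ≤ 1` keeps the coefficient `1 + δ - κ` of the bus damping nonnegative below
  set κ := min κ₁ 1 with hκ
  have hκ0 : 0 < κ := by positivity
  have hκ1 : κ ≤ 1 := min_le_right _ _
  refine ⟨δ, hδ, κ * min κ₂ 1, by positivity, fun ξ ξ' f b b' h hf hξ' => ?_⟩
  rw [h.energyDeriv_eq]
  set S : ℝ := ∑ k, P.D (P.bus k) * P.ω b (P.bus k) ^ 2 / P.numUnits (P.bus k) with hS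
  have hS1 : S ≤ ∑ j, P.D j * P.ω b j ^ 2 :=
    P.sum_div_numUnits_le (c := fun j => P.D j * P.ω b j ^ 2)
      fun j => mul_nonneg (P.D_pos j).le (sq_nonneg _)
  have hx : ∑ k : G ⊕ L, Sum.elim (P.x b) (0 : L → ℝ) k ^ 2 = ∑ k, P.x b k ^ 2 := by
    simp [Fintype.sum_sum_type]
  have hsum : ∑ k, (δ * P.ω b (P.bus k) *
        (P.h k * (P.pc b k - P.ω b (P.bus k)) + Sum.elim (P.x b) 0 k)
        - P.h k * (P.pc b k - P.ω b (P.bus k)) ^ 2 + P.pc b k * f k + ξ' k / 2 * P.pc b k ^ 2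
        - Sum.elim (P.x b) 0 k ^ 2 / Sum.elim P.m 1 k) ≤
      (1 + δ - κ) * S - κ * ∑ k, P.pc b k ^ 2 - κ * ∑ k, P.x b k ^ 2 := by
    rw [← hx, hS, Finset.mul_sum, Finset.mul_sum, Finset.mul_sum, ← Finset.sum_sub_distrib,
      ← Finset.sum_sub_distrib]
    refine Finset.sum_le_sum fun k _ => ?_
    have h1 := hunit k (P.ω b (P.bus k)) (P.pc b k) (Sum.elim (P.x b) 0 k) (f k) (hf k)
    have h2 : ξ' k / 2 * P.pc b k ^ 2 ≤ βhat k / 2 * P.pc b k ^ 2 := by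
      have := hξ' k
      gcongr
    have h3 : κ * (P.D (P.bus k) / P.numUnits (P.bus k) * P.ω b (P.bus k) ^ 2 + P.pc b k ^ 2
        + Sum.elim (P.x b) (0 : L → ℝ) k ^ 2) ≤
        κ₀ k * (P.D (P.bus k) / P.numUnits (P.bus k) * P.ω b (P.bus k) ^ 2 + P.pc b k ^ 2
        + Sum.elim (P.x b) (0 : L → ℝ) k ^ 2) := by
      have h4 := (P.D_div_numUnits_pos k).le
      have h5 : κ ≤ κ₀ k := (min_le_left _ _).trans (hκ₁' k)
      gcongr
    have h4 : P.D (P.bus k) * P.ω b (P.bus k) ^ 2 / P.numUnits (P.bus k) =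
        P.D (P.bus k) / P.numUnits (P.bus k) * P.ω b (P.bus k) ^ 2 := by ring
    rw [h4]
    linarith
  have h1 : (1 + δ - κ) * S ≤ (1 + δ - κ) * ∑ j, P.D j * P.ω b j ^ 2 := by
    gcongr
    linarith
  have h2 : min κ₂ 1 * ∑ j, P.ω b j ^ 2 ≤ ∑ j, P.D j * P.ω b j ^ 2 :=
    (mul_le_mul_of_nonneg_right (min_le_left _ _)
      (Finset.sum_nonneg fun _ _ => sq_nonneg _)).trans (hκ₂' _)
  have h3 : min κ₂ 1 * ∑ k, P.pc b k ^ 2 ≤ ∑ k, P.pc b k ^ 2 :=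
    mul_le_of_le_one_left (Finset.sum_nonneg fun _ _ => sq_nonneg _) (min_le_right _ _)
  have h4 : min κ₂ 1 * ∑ k, P.x b k ^ 2 ≤ ∑ k, P.x b k ^ 2 :=
    mul_le_of_le_one_left (Finset.sum_nonneg fun _ _ => sq_nonneg _) (min_le_right _ _)
  have h5 := mul_le_mul_of_nonneg_left (add_le_add (add_le_add h2 h3) h4) hκ0.le
  unfold damped
  linarith

end PowerSystem

/-! ### Cross terms and comparison of the quadratic forms -/

namespace PowerSystem

variable {N G L : Type*} [Fintype N] [Fintype G] [Fintype L]
  [DecidableEq N] [DecidableEq G] [DecidableEq L]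

lemma damped_nonneg (P : PowerSystem N G L) (b : P.State) : 0 ≤ P.damped b := by
  unfold damped; positivity

lemma abs_coord_le_sqrt_damped (P : PowerSystem N G L) (b : P.State) :
    (∀ j, |P.ω b j| ≤ √(P.damped b)) ∧ (∀ k, |P.pc b k| ≤ √(P.damped b)) ∧
      ∀ k, |P.x b k| ≤ √(P.damped b) := by
  have h1 : 0 ≤ ∑ j, P.ω b j ^ 2 := by positivity
  have h2 : 0 ≤ ∑ j, P.pc b j ^ 2 := by positivity
  have h3 : 0 ≤ ∑ j, P.x b j ^ 2 := by positivity
  refine ⟨fun j => Real.abs_le_sqrt ?_, fun j => Real.abs_le_sqrt ?_,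
    fun j => Real.abs_le_sqrt ?_⟩ <;> unfold damped
  · linarith [Finset.single_le_sum (f := fun j => P.ω b j ^ 2) (fun _ _ => sq_nonneg _)
      (Finset.mem_univ j)]
  · linarith [Finset.single_le_sum (f := fun j => P.pc b j ^ 2) (fun _ _ => sq_nonneg _)
      (Finset.mem_univ j)]
  · linarith [Finset.single_le_sum (f := fun j => P.x b j ^ 2) (fun _ _ => sq_nonneg _)
      (Finset.mem_univ j)]

lemma abs_output_le (P : PowerSystem N G L) (b : P.State) (k : G ⊕ L) :
    |P.output b k| ≤ (2 * P.h k + 1) * √(P.damped b) := by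
  obtain ⟨h1, h2, h3⟩ := P.abs_coord_le_sqrt_damped b
  have h4 : |Sum.elim (P.x b) (0 : L → ℝ) k| ≤ √(P.damped b) := by
    rcases k with g | l
    · exact h3 g
    · change |(0 : ℝ)| ≤ _
      rw [abs_zero]; exact Real.sqrt_nonneg _
  calc |P.output b k| ≤ |P.h k * (P.pc b k - P.ω b (P.bus k))| + |Sum.elim (P.x b) 0 k| :=
        abs_add_le _ _
    _ ≤ P.h k * (√(P.damped b) + √(P.damped b)) + √(P.damped b) := by
        rw [abs_mul, abs_of_pos (P.h_pos k)]
        have := P.h_pos k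
        gcongr
        exact (abs_sub _ _).trans (add_le_add (h2 k) (h1 _))
    _ = _ := by ring

/-- Young's inequality for `(r - φ) φ`, divided by a weight `c ≥ c₀`. -/
lemma _root_.sub_mul_div_le_of_abs_le {r φ a s c₀ c : ℝ} (hr : |r| ≤ a * s) (hc₀ : 0 < c₀)
    (hc : c₀ ≤ c) : (r - φ) * φ / c ≤ a ^ 2 / (2 * c₀) * s ^ 2 - φ ^ 2 / c / 2 := by
  have hc' : 0 < c := hc₀.trans_le hc
  have h1 : r ^ 2 ≤ a ^ 2 * s ^ 2 := by
    rw [← sq_abs, ← mul_pow]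
    exact pow_le_pow_left₀ (abs_nonneg _) hr 2
  have h2 : (r - φ) * φ / c = r ^ 2 / (2 * c) - φ ^ 2 / c / 2 - (r - φ) ^ 2 / (2 * c) := by
    field_simp; ring
  have h3 : r ^ 2 / (2 * c) ≤ a ^ 2 * s ^ 2 / (2 * c₀) := by gcongr
  have h4 : 0 ≤ (r - φ) ^ 2 / (2 * c) := by positivity
  have h5 : a ^ 2 / (2 * c₀) * s ^ 2 = a ^ 2 * s ^ 2 / (2 * c₀) := by ring
  linarith

lemma _root_.mul_le_of_abs_le_mul {u v a s : ℝ} (hu : |u| ≤ s) (hv : |v| ≤ a * s) :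
    u * v ≤ a * s ^ 2 := by
  calc u * v ≤ |u| * |v| := by rw [← abs_mul]; exact le_abs_self _
    _ ≤ s * (a * s) := mul_le_mul hu hv (abs_nonneg _) ((abs_nonneg _).trans hu)
    _ = _ := by ring

/-- The cross terms dissipate the forces, at a cost that is controlled by the coordinates that are
damped directly. -/
lemma exists_crossDeriv_le (P : PowerSystem N G L) (β : G ⊕ L → ℝ) (hβ : ∀ k, 0 < β k) :
    ∃ C > 0, ∀ (ξ f : G ⊕ L → ℝ) (b b' : P.State), P.ErrorDynamics ξ f b b' →
      (∀ k, |f k| ≤ β k * |P.ω b (P.bus k)|) → (∀ k, 0 ≤ ξ k) →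
      P.crossDeriv b b' ≤ C * P.damped b - P.force ξ b / 2 := by
  let c₁ : N → ℝ := fun j => ∑ k with P.bus k = j, (2 * P.h k + 1) + P.D j
  let c₂ : N → ℝ := fun j => ∑ e, |incidence P.lines j e| * (P.B e * 2)
  let c₃ : G ⊕ L → ℝ := fun k => 2 * P.h k + 1 + β k
  let c₄ : G ⊕ L → ℝ := fun k => ∑ e, |P.H k e| * (2 / P.γ' e)
  have hc₂ : ∀ j, 0 ≤ c₂ j := fun j => Finset.sum_nonneg fun e _ =>
    mul_nonneg (abs_nonneg _) (mul_nonneg (P.B_pos e).le zero_le_two)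
  have hc₄ : ∀ k, 0 ≤ c₄ k := fun k => Finset.sum_nonneg fun e _ =>
    mul_nonneg (abs_nonneg _) (div_nonneg zero_le_two (P.γ'_pos e).le)
  refine ⟨∑ j, (c₁ j ^ 2 / (2 * 1) + P.M j * c₂ j) + ∑ k, (c₃ k ^ 2 / (2 * P.γ k) + c₄ k) + 1,
    ?_, fun ξ f b b' h hf hξ => ?_⟩
  · have h1 : 0 ≤ ∑ j, (c₁ j ^ 2 / (2 * 1) + P.M j * c₂ j) := Finset.sum_nonneg fun j _ => by
      have := hc₂ j
      have := (P.M_pos j).le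
      positivity
    have h2 : 0 ≤ ∑ k, (c₃ k ^ 2 / (2 * P.γ k) + c₄ k) := Finset.sum_nonneg fun k _ => by
      have := hc₄ k
      have := (P.γ_pos k).le
      positivity
    linarith
  obtain ⟨hω, hp, hx⟩ := P.abs_coord_le_sqrt_damped b
  set s := √(P.damped b) with hs
  have hs2 : P.damped b = s ^ 2 := (Real.sq_sqrt (P.damped_nonneg b)).symm
  have hN : ∀ j, P.M j * (P.ω b' j * (incidence P.lines).mulVec (P.p b) j
      + P.ω b j * (incidence P.lines).mulVec (P.p b') j) ≤
      (c₁ j ^ 2 / (2 * 1) + P.M j * c₂ j) * s ^ 2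
        - (incidence P.lines).mulVec (P.p b) j ^ 2 / 2 := fun j => by
    have h1 : |∑ k with P.bus k = j, P.output b k - P.D j * P.ω b j| ≤ c₁ j * s := by
      rw [add_mul, Finset.sum_mul]
      refine (abs_sub _ _).trans (add_le_add ((Finset.abs_sum_le_sum_abs _ _).trans
        (Finset.sum_le_sum fun k _ => P.abs_output_le b k)) ?_)
      rw [abs_mul, abs_of_pos (P.D_pos j)]
      exact mul_le_mul_of_nonneg_left (hω j) (P.D_pos j).le
    have h2 : |(incidence P.lines).mulVec (P.p b') j| ≤ c₂ j * s :=
      abs_mulVec_le _ (fun e => by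
        rw [p, h.angle e, abs_mul, abs_of_pos (P.B_pos e), mul_assoc, two_mul]
        exact mul_le_mul_of_nonneg_left ((abs_sub _ _).trans (add_le_add (hω _) (hω _)))
          (P.B_pos e).le) j
    have h3 := sub_mul_div_le_of_abs_le (φ := (incidence P.lines).mulVec (P.p b) j) h1 one_pos
      le_rfl
    have h4 := mul_le_mul_of_nonneg_left (mul_le_of_abs_le_mul (hω j) h2) (P.M_pos j).le
    rw [div_one, div_one] at h3
    rw [mul_add, ← mul_assoc, h.swing j]
    linarith
  have hK : ∀ k, P.pc b' k * P.H.mulVec (P.ψ b) k + P.pc b k * P.H.mulVec (P.ψ b') k ≤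
      (c₃ k ^ 2 / (2 * P.γ k) + c₄ k) * s ^ 2
        - P.H.mulVec (P.ψ b) k ^ 2 / (P.γ k + ξ k) / 2 := fun k => by
    have h1 : |-P.output b k + f k| ≤ c₃ k * s := by
      rw [add_mul]
      refine (abs_add_le _ _).trans (add_le_add ?_ ((hf k).trans ?_))
      · rw [abs_neg]; exact P.abs_output_le b k
      · exact mul_le_mul_of_nonneg_left (hω _) (hβ k).le
    have h2 : |P.H.mulVec (P.ψ b') k| ≤ c₄ k * s :=
      abs_mulVec_le _ (fun e => by
        have h3 : P.ψ b' e = (P.pc b e.1.1 - P.pc b e.1.2) / P.γ' e := by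
          rw [eq_div_iff (P.γ'_pos e).ne', mul_comm, h.link e]
        rw [h3, abs_div, abs_of_pos (P.γ'_pos e), div_mul_eq_mul_div, two_mul]
        have := (P.γ'_pos e).le
        gcongr
        exact (abs_sub _ _).trans (add_le_add (hp _) (hp _))) k
    have h3 := sub_mul_div_le_of_abs_le (φ := P.H.mulVec (P.ψ b) k) h1 (P.γ_pos k)
      (le_add_of_nonneg_right (hξ k))
    have h4 := mul_le_of_abs_le_mul (hp k) h2
    have h5 : P.pc b' k = (-P.output b k + f k - P.H.mulVec (P.ψ b) k) / (P.γ k + ξ k) := by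
      rw [eq_div_iff (add_pos_of_pos_of_nonneg (P.γ_pos k) (hξ k)).ne', mul_comm, h.command k]
      ring
    rw [h5, div_mul_eq_mul_div]
    linarith
  have h1 := add_le_add (Finset.sum_le_sum fun j (_ : j ∈ Finset.univ) => hN j)
    (Finset.sum_le_sum fun k (_ : k ∈ Finset.univ) => hK k)
  simp only [Finset.sum_sub_distrib, ← Finset.sum_mul, ← Finset.sum_div] at h1
  unfold crossDeriv force
  rw [hs2]
  linarith [sq_nonneg s]

/-- The sum of the squares of all coordinates. -/
def sumSq (P : PowerSystem N G L) (b : P.State) : ℝ :=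
  P.damped b + ∑ e, P.η b e ^ 2 + ∑ e, P.ψ b e ^ 2

lemma exists_sumSq_le_energy (P : PowerSystem N G L) {δ : ℝ} (hδ : 0 < δ) :
    ∃ C > 0, ∀ (ξ : G ⊕ L → ℝ) (b : P.State), (∀ k, 0 ≤ ξ k) →
      P.sumSq b ≤ C * P.energy δ ξ b := by
  obtain ⟨c₁, hc₁, h₁⟩ := exists_pos_mul_sum_sq_le P.M_pos
  obtain ⟨c₂, hc₂, h₂⟩ := exists_pos_mul_sum_sq_le P.B_pos
  obtain ⟨c₃, hc₃, h₃⟩ := exists_pos_mul_sum_sq_le P.γ'_pos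
  obtain ⟨c₄, hc₄, h₄⟩ := exists_pos_mul_sum_sq_le P.γ_pos
  obtain ⟨c₅, hc₅, h₅⟩ := exists_pos_mul_sum_sq_le fun k => div_pos (P.τ_pos k) (P.m_pos k)
  set c := min c₁ (min c₂ (min c₃ (min c₄ c₅))) with hc
  have hc0 : 0 < c := by positivity
  refine ⟨2 / c, by positivity, fun ξ b hξ => ?_⟩
  rw [div_mul_eq_mul_div, le_div_iff₀ hc0]
  have hM : c * ∑ j, P.ω b j ^ 2 ≤ ∑ j, P.M j * P.ω b j ^ 2 :=
    (mul_le_mul_of_nonneg_right (by simp [hc]) (by positivity)).trans (h₁ _)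
  have hB : c * ∑ e, P.η b e ^ 2 ≤ ∑ e, P.B e * P.η b e ^ 2 :=
    (mul_le_mul_of_nonneg_right (by simp [hc]) (by positivity)).trans (h₂ _)
  have hγ' : c * ∑ e, P.ψ b e ^ 2 ≤ ∑ e, P.γ' e * P.ψ b e ^ 2 :=
    (mul_le_mul_of_nonneg_right (by simp [hc]) (by positivity)).trans (h₃ _)
  have hγ : c * ∑ k, P.pc b k ^ 2 ≤ ∑ k, P.γ k * P.pc b k ^ 2 :=
    (mul_le_mul_of_nonneg_right (by simp [hc]) (by positivity)).trans (h₄ _)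
  have hτ : c * ∑ k, P.x b k ^ 2 ≤ ∑ k, P.τ k / P.m k * P.x b k ^ 2 :=
    (mul_le_mul_of_nonneg_right (by simp [hc]) (by positivity)).trans (h₅ _)
  have hγξ : ∑ k, P.γ k * P.pc b k ^ 2 ≤ ∑ k, (P.γ k + ξ k) * P.pc b k ^ 2 :=
    Finset.sum_le_sum fun k _ => by
      have := hξ k
      gcongr
      linarith
  have h0 : 0 ≤ δ * (∑ j, P.M j * P.ω b j ^ 2 + ∑ e, P.B e * P.η b e ^ 2) := by
    have h1 : 0 ≤ c * ∑ j, P.ω b j ^ 2 := by positivity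
    have h2 : 0 ≤ c * ∑ j, P.η b j ^ 2 := by positivity
    exact mul_nonneg hδ.le (by linarith)
  unfold sumSq damped energy
  linarith

/-- The inertias `γ + ξ` may grow linearly in time, so that the energy is only bounded by a time
factor `T` times its dissipation; this still suffices, since `1 / T` is not integrable. The
assumptions on `η` and `ψ` say that they have no circulating component. -/
lemma exists_energy_le (P : PowerSystem N G L) {δ : ℝ} (hδ : 0 < δ) {c₀ : ℝ} (hc₀ : 0 < c₀) :
    ∃ C > 0, ∀ (ξ : G ⊕ L → ℝ) (b : P.State) (T : ℝ), (∀ k, 0 ≤ ξ k) → 1 ≤ T →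
      (∀ k, P.γ k + ξ k ≤ c₀ * T) →
      (∀ y, (incidence P.lines).mulVec y = 0 → ∑ e, y e * P.η b e = 0) →
      (∀ y, P.H.mulVec y = 0 → ∑ e, P.γ' e * y e * P.ψ b e = 0) →
      P.energy δ ξ b ≤ C * T * (P.damped b + P.force ξ b) := by
  obtain ⟨c₁, hc₁, h₁⟩ := exists_sum_mul_sq_le P.M
  obtain ⟨c₂, hc₂, h₂⟩ := exists_sum_sq_le_divergence P.lines (w := fun e => (P.B e)⁻¹)
    fun e => inv_pos.2 (P.B_pos e)
  obtain ⟨c₃, hc₃, h₃⟩ := exists_sum_mul_sq_le P.γ'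
  obtain ⟨c₃', hc₃', h₃'⟩ := exists_sum_sq_le_divergence P.links P.γ'_pos
  obtain ⟨c₅, hc₅, h₅⟩ := exists_sum_mul_sq_le fun k => P.τ k / P.m k
  obtain ⟨c₆, hc₆, h₆⟩ := exists_sum_mul_sq_le fun e => (P.B e)⁻¹
  refine ⟨(1 + δ) * (c₁ + c₆ * c₂) + c₃ * c₃' * c₀ + c₀ + c₅, by positivity,
    fun ξ b T hξ hT hξT hη hψ => ?_⟩
  set Sω := ∑ j, P.ω b j ^ 2 with hSω
  set Sp := ∑ k, P.pc b k ^ 2 with hSp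
  set Sx := ∑ k, P.x b k ^ 2 with hSx
  set Sf := ∑ j, (incidence P.lines).mulVec (P.p b) j ^ 2 with hSf
  set Sφ := ∑ k, P.H.mulVec (P.ψ b) k ^ 2 / (P.γ k + ξ k) with hSφ
  have hSω0 : 0 ≤ Sω := by positivity
  have hSp0 : 0 ≤ Sp := by positivity
  have hSx0 : 0 ≤ Sx := by positivity
  have hSf0 : 0 ≤ Sf := by positivity
  have hγξ : ∀ k, 0 < P.γ k + ξ k := fun k => add_pos_of_pos_of_nonneg (P.γ_pos k) (hξ k)
  have hSφ0 : 0 ≤ Sφ := Finset.sum_nonneg fun k _ => div_nonneg (sq_nonneg _) (hγξ k).le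
  have hT0 : 0 ≤ T := by linarith
  have hB : ∑ e, P.B e * P.η b e ^ 2 ≤ c₆ * c₂ * Sf := by
    have h1 : ∑ e, P.B e * P.η b e ^ 2 = ∑ e, (P.B e)⁻¹ * P.p b e ^ 2 :=
      Finset.sum_congr rfl fun e _ => by
        have := (P.B_pos e).ne'
        unfold p
        field_simp
    have h2 := h₂ (P.p b) fun y hy => by
      rw [← hη y hy]
      refine Finset.sum_congr rfl fun e _ => ?_
      have := (P.B_pos e).ne'
      unfold p
      field_simp
    rw [h1]
    refine (h₆ _).trans ?_
    rw [mul_assoc]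
    exact mul_le_mul_of_nonneg_left h2 hc₆.le
  have hγ' : ∑ e, P.γ' e * P.ψ b e ^ 2 ≤ c₃ * c₃' * c₀ * (T * Sφ) := by
    have h1 : ∑ k, P.H.mulVec (P.ψ b) k ^ 2 ≤ c₀ * (T * Sφ) := by
      rw [hSφ, ← mul_assoc, Finset.mul_sum]
      refine Finset.sum_le_sum fun k _ => ?_
      rw [mul_div_assoc', le_div_iff₀ (hγξ k), mul_comm]
      exact mul_le_mul_of_nonneg_right (hξT k) (sq_nonneg _)
    calc _ ≤ c₃ * ∑ e, P.ψ b e ^ 2 := h₃ _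
      _ ≤ c₃ * (c₃' * ∑ k, P.H.mulVec (P.ψ b) k ^ 2) := by
        gcongr; exact h₃' _ hψ
      _ ≤ c₃ * (c₃' * (c₀ * (T * Sφ))) := by gcongr
      _ = _ := by ring
  have hp : ∑ k, (P.γ k + ξ k) * P.pc b k ^ 2 ≤ c₀ * (T * Sp) := by
    rw [hSp, ← mul_assoc, Finset.mul_sum]
    exact Finset.sum_le_sum fun k _ => mul_le_mul_of_nonneg_right (hξT k) (sq_nonneg _)
  have hM : ∑ j, P.M j * P.ω b j ^ 2 ≤ c₁ * Sω := h₁ _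
  have hx : ∑ k, P.τ k / P.m k * P.x b k ^ 2 ≤ c₅ * Sx := h₅ _
  have hW : ∀ u, u ≤ P.damped b + P.force ξ b → 0 ≤ u → u ≤ T * (P.damped b + P.force ξ b) :=
    fun u hu hu0 => hu.trans (le_mul_of_one_le_left (hu0.trans hu) hT)
  have hWe : P.damped b + P.force ξ b = Sω + Sp + Sx + (Sf + Sφ) := rfl
  set W := T * (P.damped b + P.force ξ b) with hWdef
  have hWω : c₁ * Sω ≤ c₁ * W := by gcongr; exact hW _ (by linarith) hSω0
  have hWf : c₆ * c₂ * Sf ≤ c₆ * c₂ * W := by gcongr; exact hW _ (by linarith) hSf0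
  have hWx : c₅ * Sx ≤ c₅ * W := by gcongr; exact hW _ (by linarith) hSx0
  have hWφ : c₃ * c₃' * c₀ * (T * Sφ) ≤ c₃ * c₃' * c₀ * W := by
    gcongr; exact mul_le_mul_of_nonneg_left (by linarith) hT0
  have hWp : c₀ * (T * Sp) ≤ c₀ * W := by
    gcongr; exact mul_le_mul_of_nonneg_left (by linarith) hT0
  have h1 : (1 + δ) * (∑ j, P.M j * P.ω b j ^ 2 + ∑ e, P.B e * P.η b e ^ 2) ≤
      (1 + δ) * (c₁ * W + c₆ * c₂ * W) := by gcongr <;> linarith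
  have hW0 : 0 ≤ W := mul_nonneg hT0 (by linarith)
  have h2 : 0 ≤ ((1 + δ) * (c₁ + c₆ * c₂) + c₃ * c₃' * c₀ + c₀ + c₅) * W := by positivity
  have h3 : ((1 + δ) * (c₁ + c₆ * c₂) + c₃ * c₃' * c₀ + c₀ + c₅) * T *
      (P.damped b + P.force ξ b) = ((1 + δ) * (c₁ + c₆ * c₂) + c₃ * c₃' * c₀ + c₀ + c₅) * W := by
    rw [hWdef]; ring
  rw [h3]
  unfold energy
  linarith

lemma exists_abs_cross_le (P : PowerSystem N G L) :
    ∃ C > 0, ∀ b : P.State, |P.cross b| ≤ C * P.sumSq b := by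
  obtain ⟨c₁, hc₁, h₁⟩ := exists_sum_mul_sq_le P.M
  obtain ⟨c₂, hc₂, h₂⟩ := exists_sum_mul_sq_le fun e => P.B e ^ 2
  set a := ∑ j, ∑ e, incidence P.lines j e ^ 2 with ha
  set a' := ∑ k, ∑ e, P.H k e ^ 2 with ha'
  have ha0 : 0 ≤ a := by positivity
  have ha0' : 0 ≤ a' := by positivity
  refine ⟨c₁ + c₁ * (a * c₂) + 1 + a', by positivity, fun b => ?_⟩
  have hf : ∑ j, (incidence P.lines).mulVec (P.p b) j ^ 2 ≤ a * (c₂ * ∑ e, P.η b e ^ 2) := by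
    refine (sum_mulVec_sq_le _ _).trans (mul_le_mul_of_nonneg_left ?_ ha0)
    have h := h₂ (P.η b)
    simpa only [p, mul_pow] using h
  have hφ : ∑ k, P.H.mulVec (P.ψ b) k ^ 2 ≤ a' * ∑ e, P.ψ b e ^ 2 := sum_mulVec_sq_le _ _
  have hyoung : ∀ u v : ℝ, |u * v| ≤ u ^ 2 + v ^ 2 := fun u v => by
    rw [abs_le]
    constructor <;> nlinarith [sq_nonneg (u + v), sq_nonneg (u - v)]
  have h1 : |∑ j, P.M j * (P.ω b j * (incidence P.lines).mulVec (P.p b) j)| ≤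
      c₁ * ∑ j, P.ω b j ^ 2 + c₁ * ∑ j, (incidence P.lines).mulVec (P.p b) j ^ 2 := by
    refine (Finset.abs_sum_le_sum_abs _ _).trans ((Finset.sum_le_sum fun j _ => ?_).trans
      ((Finset.sum_add_distrib (f := fun j => P.M j * P.ω b j ^ 2)
        (g := fun j => P.M j * (incidence P.lines).mulVec (P.p b) j ^ 2)).le.trans
        (add_le_add (h₁ _) (h₁ _))))
    rw [abs_mul, abs_of_pos (P.M_pos j), ← mul_add]
    exact mul_le_mul_of_nonneg_left (hyoung _ _) (P.M_pos j).le
  have h2 : |∑ k, P.pc b k * P.H.mulVec (P.ψ b) k| ≤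
      ∑ k, P.pc b k ^ 2 + ∑ k, P.H.mulVec (P.ψ b) k ^ 2 := by
    rw [← Finset.sum_add_distrib]
    exact (Finset.abs_sum_le_sum_abs _ _).trans (Finset.sum_le_sum fun k _ => hyoung _ _)
  have h3 := mul_le_mul_of_nonneg_left hf hc₁.le
  set Sω := ∑ j, P.ω b j ^ 2 with hSω
  set Sp := ∑ k, P.pc b k ^ 2 with hSp
  set Sx := ∑ k, P.x b k ^ 2 with hSx
  set Sη := ∑ e, P.η b e ^ 2 with hSη
  set Sψ := ∑ e, P.ψ b e ^ 2 with hSψ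
  have hSω0 : 0 ≤ Sω := by positivity
  have hSp0 : 0 ≤ Sp := by positivity
  have hSx0 : 0 ≤ Sx := by positivity
  have hSη0 : 0 ≤ Sη := by positivity
  have hSψ0 : 0 ≤ Sψ := by positivity
  have hS : P.sumSq b = Sω + Sp + Sx + Sη + Sψ := rfl
  have h4 : c₁ * Sω ≤ c₁ * P.sumSq b := by gcongr; linarith
  have h5 : c₁ * (a * c₂) * Sη ≤ c₁ * (a * c₂) * P.sumSq b := by gcongr; linarith
  have h6 : a' * Sψ ≤ a' * P.sumSq b := by gcongr; linarith
  have h7 : |P.cross b| ≤ _ := abs_add_le _ _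
  linarith

end PowerSystem

/-! ### Decay along differential inequalities -/

lemma antitoneOn_Ici_of_hasDerivWithinAt_nonpos {f f' : ℝ → ℝ}
    (hf : ∀ t, 0 ≤ t → HasDerivWithinAt f (f' t) (Ici 0) t) (hf' : ∀ t, 0 ≤ t → f' t ≤ 0) :
    AntitoneOn f (Ici 0) := by
  have h : ∀ t ∈ interior (Ici (0 : ℝ)), HasDerivAt f (f' t) t := fun t ht => by
    rw [interior_Ici] at ht
    exact (hf t (le_of_lt ht)).hasDerivAt (Ici_mem_nhds ht)
  refine antitoneOn_of_deriv_nonpos (convex_Ici 0) (fun t ht => (hf t ht).continuousWithinAt)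
    (fun t ht => (h t ht).differentiableAt.differentiableWithinAt) fun t ht => ?_
  rw [(h t ht).deriv]
  exact hf' t (interior_subset ht)

lemma eq_of_hasDerivWithinAt_Ici_zero {f : ℝ → ℝ}
    (hf : ∀ t, 0 ≤ t → HasDerivWithinAt f 0 (Ici 0) t) {t : ℝ} (ht : 0 ≤ t) : f t = f 0 := by
  have h1 := antitoneOn_Ici_of_hasDerivWithinAt_nonpos hf (fun _ _ => le_rfl)
    self_mem_Ici ht ht
  have h2 := antitoneOn_Ici_of_hasDerivWithinAt_nonpos (fun t ht => (hf t ht).fun_neg)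
    (fun _ _ => neg_zero.le) self_mem_Ici ht ht
  linarith

/-- A Grönwall estimate: `f` decays at least as fast as `(1 + t) ^ (-r)`. -/
lemma tendsto_zero_of_deriv_mul_le {f f' : ℝ → ℝ} {r : ℝ} (hr : 0 < r)
    (hf : ∀ t, 0 ≤ t → HasDerivWithinAt f (f' t) (Ici 0) t)
    (hf' : ∀ t, 0 ≤ t → f' t * (1 + t) ≤ -r * f t) (hf0 : ∀ t, 0 ≤ t → 0 ≤ f t) :
    Tendsto f atTop (𝓝 0) := by
  have h1 : ∀ t : ℝ, 0 ≤ t → HasDerivWithinAt (fun t => f t * (1 + t) ^ r)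
      (f' t * (1 + t) ^ r + f t * (1 * r * (1 + t) ^ (r - 1))) (Ici 0) t := fun t ht =>
    (hf t ht).mul (((hasDerivWithinAt_id t _).const_add 1).rpow_const
      (Or.inl (by simp only [id]; linarith)))
  have h2 := antitoneOn_Ici_of_hasDerivWithinAt_nonpos h1 fun t ht => by
    have ht' : 0 < 1 + t := by linarith
    have h3 : (1 + t) ^ r = (1 + t) ^ (r - 1) * (1 + t) := by
      rw [Real.rpow_sub_one ht'.ne']; field_simp
    have h4 : f' t * (1 + t) ^ r + f t * (1 * r * (1 + t) ^ (r - 1))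
        = (1 + t) ^ (r - 1) * (f' t * (1 + t) + r * f t) := by rw [h3]; ring
    rw [h4]
    exact mul_nonpos_of_nonneg_of_nonpos (Real.rpow_nonneg ht'.le _) (by linarith [hf' t ht])
  have h3 : ∀ t, 0 ≤ t → f t ≤ f 0 * (1 + t) ^ (-r) := fun t ht => by
    have ht' : 0 < 1 + t := by linarith
    have h4 : f t * (1 + t) ^ r ≤ f 0 * (1 + 0) ^ r := h2 self_mem_Ici ht ht
    rw [add_zero, Real.one_rpow, mul_one] at h4
    rwa [Real.rpow_neg ht'.le, ← div_eq_mul_inv, le_div_iff₀ (Real.rpow_pos_of_pos ht' _)]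
  have h4 : Tendsto (fun t : ℝ => f 0 * (1 + t) ^ (-r)) atTop (𝓝 0) := by
    simpa using ((tendsto_rpow_neg_atTop hr).comp (tendsto_atTop_add_const_left _ 1
      tendsto_id)).const_mul (f 0)
  exact squeeze_zero' (eventually_atTop.2 ⟨0, hf0⟩) (eventually_atTop.2 ⟨0, h3⟩) h4

lemma HasDerivWithinAt.matrix_mulVec {m n : Type*} [Fintype n] (A : Matrix m n ℝ)
    {z : ℝ → n → ℝ} {z' : n → ℝ} {s : Set ℝ} {t : ℝ}
    (h : ∀ j, HasDerivWithinAt (fun t => z t j) (z' j) s t) (i : m) :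
    HasDerivWithinAt (fun t => A.mulVec (z t) i) (A.mulVec z' i) s t :=
  HasDerivWithinAt.fun_sum fun j _ => (h j).const_mul (A i j)

/-! ### Convergence of the error -/

namespace PowerSystem

variable {N G L : Type*} [Fintype N] [Fintype G] [Fintype L]
  [DecidableEq N] [DecidableEq G] [DecidableEq L]

/-- All coordinates of the curve `b` have the derivatives given by the coordinates of `b'`. -/
structure HasCoordDeriv (P : PowerSystem N G L) (b : ℝ → P.State) (b' : P.State) (t : ℝ) :
    Prop where
  η : ∀ e, HasDerivWithinAt (fun t => P.η (b t) e) (P.η b' e) (Ici 0) t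
  ψ : ∀ e, HasDerivWithinAt (fun t => P.ψ (b t) e) (P.ψ b' e) (Ici 0) t
  ω : ∀ j, HasDerivWithinAt (fun t => P.ω (b t) j) (P.ω b' j) (Ici 0) t
  x : ∀ k, HasDerivWithinAt (fun t => P.x (b t) k) (P.x b' k) (Ici 0) t
  pc : ∀ k, HasDerivWithinAt (fun t => P.pc (b t) k) (P.pc b' k) (Ici 0) t

lemma _root_.HasDerivWithinAt.hasCoordDeriv {P : PowerSystem N G L} {b : ℝ → P.State}
    {b' : P.State} {t : ℝ} (h : HasDerivWithinAt b b' (Ici 0) t) : P.HasCoordDeriv b b' t := by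
  have h1 : HasDerivWithinAt (fun t => (b t).1) b'.1 (Ici 0) t := by
    simpa using h.hasFDerivWithinAt.fst.hasDerivWithinAt
  have h2 : HasDerivWithinAt (fun t => (b t).2) b'.2 (Ici 0) t := by
    simpa using h.hasFDerivWithinAt.snd.hasDerivWithinAt
  have h3 : HasDerivWithinAt (fun t => (b t).2.1) b'.2.1 (Ici 0) t := by
    simpa using h2.hasFDerivWithinAt.fst.hasDerivWithinAt
  have h4 : HasDerivWithinAt (fun t => (b t).2.2) b'.2.2 (Ici 0) t := by
    simpa using h2.hasFDerivWithinAt.snd.hasDerivWithinAt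
  have h5 : HasDerivWithinAt (fun t => (b t).2.2.1) b'.2.2.1 (Ici 0) t := by
    simpa using h4.hasFDerivWithinAt.fst.hasDerivWithinAt
  have h6 : HasDerivWithinAt (fun t => (b t).2.2.2) b'.2.2.2 (Ici 0) t := by
    simpa using h4.hasFDerivWithinAt.snd.hasDerivWithinAt
  have h7 : HasDerivWithinAt (fun t => (b t).2.2.2.1) b'.2.2.2.1 (Ici 0) t := by
    simpa using h6.hasFDerivWithinAt.fst.hasDerivWithinAt
  have h8 : HasDerivWithinAt (fun t => (b t).2.2.2.2) b'.2.2.2.2 (Ici 0) t := by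
    simpa using h6.hasFDerivWithinAt.snd.hasDerivWithinAt
  exact ⟨hasDerivWithinAt_pi.1 h1, hasDerivWithinAt_pi.1 h3, hasDerivWithinAt_pi.1 h5,
    hasDerivWithinAt_pi.1 h7, hasDerivWithinAt_pi.1 h8⟩

lemma HasCoordDeriv.energy {P : PowerSystem N G L} {b : ℝ → P.State} {b' : P.State} {t : ℝ}
    (h : P.HasCoordDeriv b b' t) {ξ : ℝ → G ⊕ L → ℝ} {ξ' : G ⊕ L → ℝ}
    (hξ : ∀ k, HasDerivWithinAt (fun t => ξ t k) (ξ' k) (Ici 0) t) (δ : ℝ) :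
    HasDerivWithinAt (fun t => P.energy δ (ξ t) (b t)) (P.energyDeriv δ (ξ t) ξ' (b t) b')
      (Ici 0) t := by
  have hM := HasDerivWithinAt.fun_sum (u := Finset.univ) fun j _ =>
    ((h.ω j).fun_pow 2).const_mul (P.M j)
  have hB := HasDerivWithinAt.fun_sum (u := Finset.univ) fun e _ =>
    ((h.η e).fun_pow 2).const_mul (P.B e)
  have hψ := HasDerivWithinAt.fun_sum (u := Finset.univ) fun e _ =>
    ((h.ψ e).fun_pow 2).const_mul (P.γ' e)
  have hp := HasDerivWithinAt.fun_sum (u := Finset.univ) fun k _ =>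
    ((hξ k).const_add (P.γ k)).fun_mul ((h.pc k).fun_pow 2)
  have hx := HasDerivWithinAt.fun_sum (u := Finset.univ) fun k _ =>
    ((h.x k).fun_pow 2).const_mul (P.τ k / P.m k)
  refine (((((hM.fun_add hB).const_mul (1 + δ)).fun_add hψ).fun_add hp).fun_add hx).div_const 2
    |>.congr_deriv ?_
  unfold energyDeriv
  rw [div_eq_iff two_ne_zero]
  simp only [add_mul, mul_add, Finset.mul_sum, Finset.sum_mul]
  congr 1
  · congr 1
    · congr 1
      · congr 1 <;> · congr 1; ext; push_cast; ring
      · congr 1; ext; push_cast; ring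
    · congr 1; ext; push_cast; ring
  · congr 1; ext; push_cast; ring

lemma HasCoordDeriv.cross {P : PowerSystem N G L} {b : ℝ → P.State} {b' : P.State} {t : ℝ}
    (h : P.HasCoordDeriv b b' t) :
    HasDerivWithinAt (fun t => P.cross (b t)) (P.crossDeriv (b t) b') (Ici 0) t :=
  (HasDerivWithinAt.fun_sum fun j _ => ((h.ω j).fun_mul
    (HasDerivWithinAt.matrix_mulVec _ (fun e => (h.η e).const_mul (P.B e)) j)).const_mul
      (P.M j)).fun_add
    (HasDerivWithinAt.fun_sum fun k _ => (h.pc k).fun_mul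
      (HasDerivWithinAt.matrix_mulVec _ h.ψ k))

lemma norm_le_sqrt_sumSq (P : PowerSystem N G L) (b : P.State) : ‖b‖ ≤ √(P.sumSq b) := by
  have hle : √(P.damped b) ≤ √(P.sumSq b) := Real.sqrt_le_sqrt (by
    have h1 : 0 ≤ ∑ e, P.η b e ^ 2 := by positivity
    have h2 : 0 ≤ ∑ e, P.ψ b e ^ 2 := by positivity
    unfold sumSq
    linarith)
  obtain ⟨h1, h2, h3⟩ := P.abs_coord_le_sqrt_damped b
  have h0 := Real.sqrt_nonneg (P.sumSq b)
  have hd := P.damped_nonneg b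
  have hη : ∀ e, |P.η b e| ≤ √(P.sumSq b) := fun e => Real.abs_le_sqrt (by
    have h1 : 0 ≤ ∑ e, P.ψ b e ^ 2 := by positivity
    have h2 := Finset.single_le_sum (f := fun e => P.η b e ^ 2) (fun _ _ => sq_nonneg _)
      (Finset.mem_univ e)
    unfold sumSq
    linarith)
  have hψ : ∀ e, |P.ψ b e| ≤ √(P.sumSq b) := fun e => Real.abs_le_sqrt (by
    have h1 : 0 ≤ ∑ e, P.η b e ^ 2 := by positivity
    have h2 := Finset.single_le_sum (f := fun e => P.ψ b e ^ 2) (fun _ _ => sq_nonneg _)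
      (Finset.mem_univ e)
    unfold sumSq
    linarith)
  refine norm_prod_le_iff.2 ⟨(pi_norm_le_iff_of_nonneg h0).2 hη, norm_prod_le_iff.2
    ⟨(pi_norm_le_iff_of_nonneg h0).2 hψ, norm_prod_le_iff.2
      ⟨(pi_norm_le_iff_of_nonneg h0).2 fun j => (h1 j).trans hle, norm_prod_le_iff.2
        ⟨(pi_norm_le_iff_of_nonneg h0).2 fun j => (h3 j).trans hle,
          (pi_norm_le_iff_of_nonneg h0).2 fun j => (h2 j).trans hle⟩⟩⟩⟩

/-- The absence of circulating components of `η` and `ψ` is conserved. -/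
lemma orthogonal_of_errorDynamics (P : PowerSystem N G L) {ξ f : ℝ → G ⊕ L → ℝ}
    {b b' : ℝ → P.State} (hb : ∀ t, 0 ≤ t → P.HasCoordDeriv b (b' t) t)
    (hd : ∀ t, 0 ≤ t → P.ErrorDynamics (ξ t) (f t) (b t) (b' t))
    (hη : ∀ y, (incidence P.lines).mulVec y = 0 → ∑ e, y e * P.η (b 0) e = 0)
    (hψ : ∀ y, P.H.mulVec y = 0 → ∑ e, P.γ' e * y e * P.ψ (b 0) e = 0) {t : ℝ} (ht : 0 ≤ t) :
    (∀ y, (incidence P.lines).mulVec y = 0 → ∑ e, y e * P.η (b t) e = 0) ∧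
      ∀ y, P.H.mulVec y = 0 → ∑ e, P.γ' e * y e * P.ψ (b t) e = 0 := by
  constructor
  · intro y hy
    rw [← hη y hy]
    refine eq_of_hasDerivWithinAt_Ici_zero (f := fun t => ∑ e, y e * P.η (b t) e)
      (fun t ht => ?_) ht
    refine (HasDerivWithinAt.fun_sum fun e _ => ((hb t ht).η e).const_mul (y e)).congr_deriv ?_
    rw [Finset.sum_congr rfl fun e _ => by rw [(hd t ht).angle e], ← sum_incidence_mulVec_mul, hy]
    simp
  · intro y hy
    rw [← hψ y hy]
    refine eq_of_hasDerivWithinAt_Ici_zero (f := fun t => ∑ e, P.γ' e * y e * P.ψ (b t) e)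
      (fun t ht => ?_) ht
    refine (HasDerivWithinAt.fun_sum fun e _ =>
      ((hb t ht).ψ e).const_mul (P.γ' e * y e)).congr_deriv ?_
    rw [Finset.sum_congr rfl fun e _ => by
      rw [mul_comm (P.γ' e), mul_assoc, (hd t ht).link e], ← sum_incidence_mulVec_mul]
    rw [H_eq_incidence] at hy
    simp [hy]

/-- Every admissible deviation without circulating components tends to zero. -/
lemma tendsto_sumSq_of_errorDynamics (P : PowerSystem N G L) {β βhat : G ⊕ L → ℝ}
    (hβ : ∀ k, 0 < β k) (hβhat : ∀ k, 0 < βhat k) (hLMI : P.DesignLMI β βhat)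
    {ξ ξ' f : ℝ → G ⊕ L → ℝ} {b b' : ℝ → P.State}
    (hb : ∀ t, 0 ≤ t → P.HasCoordDeriv b (b' t) t)
    (hd : ∀ t, 0 ≤ t → P.ErrorDynamics (ξ t) (f t) (b t) (b' t))
    (hf : ∀ t, 0 ≤ t → ∀ k, |f t k| ≤ β k * |P.ω (b t) (P.bus k)|)
    (hξ : ∀ t, 0 ≤ t → ∀ k, 0 ≤ ξ t k ∧
      HasDerivWithinAt (fun s => ξ s k) (ξ' t k) (Ici 0) t ∧ ξ' t k ≤ βhat k)
    (hη : ∀ y, (incidence P.lines).mulVec y = 0 → ∑ e, y e * P.η (b 0) e = 0)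
    (hψ : ∀ y, P.H.mulVec y = 0 → ∑ e, P.γ' e * y e * P.ψ (b 0) e = 0) :
    Tendsto (fun t => P.sumSq (b t)) atTop (𝓝 0) := by
  have hξle : ∀ t, 0 ≤ t → ∀ k, ξ t k ≤ ξ 0 k + βhat k * t := fun t ht k => by
    have h := antitoneOn_Ici_of_hasDerivWithinAt_nonpos (f := fun t => ξ t k - βhat k * t)
      (fun t ht => (hξ t ht k).2.1.fun_sub ((hasDerivWithinAt_id t _).const_mul (βhat k)))
      (fun t ht => by linarith [(hξ t ht k).2.2]) self_mem_Ici ht ht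
    simp only [mul_zero] at h
    linarith
  obtain ⟨c₀, hc₀, hc₀'⟩ := exists_pos_all_le fun k => P.γ k + ξ 0 k + βhat k
  have hγξ : ∀ t, 0 ≤ t → ∀ k, P.γ k + ξ t k ≤ c₀ * (1 + t) := fun t ht k => by
    have h1 := hξle t ht k
    have h2 : (P.γ k + ξ 0 k + βhat k) * (1 + t) ≤ c₀ * (1 + t) :=
      mul_le_mul_of_nonneg_right (hc₀' k) (by linarith)
    have h3 : 0 ≤ (P.γ k + ξ 0 k) * t :=
      mul_nonneg (add_nonneg (P.γ_pos k).le (hξ 0 le_rfl k).1) ht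
    linarith [hβhat k]
  obtain ⟨δ, hδ, κ, hκ, hE⟩ := P.exists_energyDeriv_le hβ hLMI
  obtain ⟨C₁, hC₁, hR⟩ := P.exists_crossDeriv_le β hβ
  obtain ⟨C₂, hC₂, hS⟩ := P.exists_sumSq_le_energy hδ
  obtain ⟨C₃, hC₃, hU⟩ := P.exists_energy_le hδ hc₀
  obtain ⟨C₄, hC₄, hX⟩ := P.exists_abs_cross_le
  -- small enough for the cross terms to be dominated both in value and in derivative
  set ε := min (κ / (2 * C₁)) (1 / (2 * (C₄ * C₂))) with hε
  have hε0 : 0 < ε := by positivity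
  have hεκ : ε * C₁ ≤ κ / 2 := by
    calc ε * C₁ ≤ κ / (2 * C₁) * C₁ := by gcongr; exact min_le_left _ _
      _ = κ / 2 := by field_simp
  have hεC : ε * (C₄ * C₂) ≤ 1 / 2 := by
    calc ε * (C₄ * C₂) ≤ 1 / (2 * (C₄ * C₂)) * (C₄ * C₂) := by gcongr; exact min_le_right _ _
      _ = 1 / 2 := by field_simp
  set c := min (κ / 2) (ε / 2) with hc
  have hc0 : 0 < c := by positivity
  have hU0 : ∀ t, 0 ≤ t → 0 ≤ P.energy δ (ξ t) (b t) := fun t ht => by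
    have h1 := hS (ξ t) (b t) fun k => (hξ t ht k).1
    have h2 : 0 ≤ P.sumSq (b t) := by
      have := P.damped_nonneg (b t)
      unfold sumSq
      positivity
    exact nonneg_of_mul_nonneg_right (h2.trans h1) hC₂
  have hcross : ∀ t, 0 ≤ t → |ε * P.cross (b t)| ≤ P.energy δ (ξ t) (b t) / 2 := fun t ht => by
    rw [abs_mul, abs_of_pos hε0]
    calc ε * |P.cross (b t)| ≤ ε * (C₄ * (C₂ * P.energy δ (ξ t) (b t))) := by
          gcongr
          exact (hX _).trans (mul_le_mul_of_nonneg_left (hS _ _ fun k => (hξ t ht k).1) hC₄.le)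
      _ = ε * (C₄ * C₂) * P.energy δ (ξ t) (b t) := by ring
      _ ≤ 1 / 2 * P.energy δ (ξ t) (b t) := mul_le_mul_of_nonneg_right hεC (hU0 t ht)
      _ = _ := by ring
  have hY := tendsto_zero_of_deriv_mul_le (r := c / (2 * C₃))
    (f := fun t => P.energy δ (ξ t) (b t) + ε * P.cross (b t)) (by positivity)
    (fun t ht => ((hb t ht).energy (fun k => (hξ t ht k).2.1) δ).fun_add
      ((hb t ht).cross.const_mul ε)) (fun t ht => by
      have hξ0 : ∀ k, 0 ≤ ξ t k := fun k => (hξ t ht k).1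
      have h1 := hE _ _ _ _ _ (hd t ht) (hf t ht) fun k => (hξ t ht k).2.2
      have h2 := mul_le_mul_of_nonneg_left (hR _ _ _ _ (hd t ht) (hf t ht) hξ0) hε0.le
      obtain ⟨h3, h3'⟩ := P.orthogonal_of_errorDynamics hb hd hη hψ ht
      have h4 := hU (ξ t) (b t) (1 + t) hξ0 (by linarith) (hγξ t ht) h3 h3'
      have h5 := (abs_le.1 (hcross t ht)).2
      have hD := P.damped_nonneg (b t)
      have hF : 0 ≤ P.force (ξ t) (b t) :=
        add_nonneg (by positivity) (Finset.sum_nonneg fun k _ => div_nonneg (sq_nonneg _)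
          (add_nonneg (P.γ_pos k).le (hξ0 k)))
      set W := P.damped (b t) + P.force (ξ t) (b t) with hW
      have h6 : P.energyDeriv δ (ξ t) (ξ' t) (b t) (b' t) + ε * P.crossDeriv (b t) (b' t) ≤
          -c * W := by
        have h7 : ε * C₁ * P.damped (b t) ≤ κ / 2 * P.damped (b t) := by gcongr
        have h8 : c * P.damped (b t) ≤ κ / 2 * P.damped (b t) := by
          gcongr; exact min_le_left _ _
        have h9 : c * P.force (ξ t) (b t) ≤ ε / 2 * P.force (ξ t) (b t) := by
          gcongr; exact min_le_right _ _
        rw [hW]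
        linarith
      calc _ ≤ -c * W * (1 + t) := mul_le_mul_of_nonneg_right h6 (by linarith)
        _ = -(c / C₃) * (C₃ * (1 + t) * W) := by field_simp
        _ ≤ -(c / C₃) * P.energy δ (ξ t) (b t) :=
          mul_le_mul_of_nonpos_left h4 (neg_nonpos.2 (by positivity))
        _ = -(c / (2 * C₃)) * (2 * P.energy δ (ξ t) (b t)) := by field_simp
        _ ≤ _ := mul_le_mul_of_nonpos_left (by linarith [hU0 t ht])
          (neg_nonpos.2 (by positivity)))
    (fun t ht => by linarith [(abs_le.1 (hcross t ht)).1, hU0 t ht])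
  have hY' : Tendsto (fun t => C₂ * 2 * (P.energy δ (ξ t) (b t) + ε * P.cross (b t))) atTop
      (𝓝 0) := by simpa using hY.const_mul (C₂ * 2)
  refine squeeze_zero' (Eventually.of_forall fun t => ?_) (eventually_atTop.2 ⟨0, fun t ht => ?_⟩)
    hY'
  · have := P.damped_nonneg (b t)
    unfold sumSq
    positivity
  · refine (hS (ξ t) (b t) fun k => (hξ t ht k).1).trans ?_
    rw [mul_assoc]
    exact mul_le_mul_of_nonneg_left
      (by linarith [(abs_le.1 (hcross t ht)).1]) hC₂.le

end PowerSystem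

end

theorem theorem2 {N G L : Type*} [Fintype N] [Fintype G] [Fintype L]
    [DecidableEq N] [DecidableEq G] [DecidableEq L] (P : PowerSystem N G L)
    (β βhat : G ⊕ L → ℝ) (hβ : ∀ k, 0 < β k) (hβhat : ∀ k, 0 < βhat k)
    (hLMI : P.DesignLMI β βhat) :
    (P.equilibria β).Nonempty ∧
    (∀ a ∈ P.equilibria β, P.ω a = 0) ∧
    ∀ (n : ℝ → G ⊕ L → ℝ) (a a' : ℝ → P.State),
      P.IsSolution n a a' → P.DesignSignal β βhat n a a' →
      Tendsto (fun t => Metric.infDist (a t) (P.equilibria β)) atTop (𝓝 0) := by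
  have hmem : ∀ a : P.State, P.Dynamics 0 a 0 → a ∈ P.equilibria β := fun a ha =>
    ⟨0, fun k => by
      rw [Pi.zero_apply, abs_zero]; exact mul_nonneg (hβ k).le (abs_nonneg _), ha⟩
  refine ⟨?_, fun a ha => P.omega_eq_zero_of_mem_equilibria hβhat hLMI ha,
    fun n a a' hsol ⟨nd, nf, ξ, ξ', hn⟩ => ?_⟩
  · obtain ⟨a, ha, -⟩ := P.exists_equilibrium 0
    exact ⟨a, hmem a ha⟩
  · obtain ⟨a₀, ha₀, hω, hη, hψ⟩ := P.exists_equilibrium (a 0)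
    have hωb : ∀ t j, P.ω (a t - a₀) j = P.ω (a t) j := fun t j => by
      change P.ω (a t) j - P.ω a₀ j = _
      rw [hω, Pi.zero_apply, sub_zero]
    have h := P.tendsto_sumSq_of_errorDynamics (b := fun t => a t - a₀) (b' := a') (ξ := ξ)
      (ξ' := ξ') (f := nf) hβ hβhat hLMI (fun t ht => ((hsol t ht).1.sub_const a₀).hasCoordDeriv)
      (fun t ht => (hsol t ht).2.error ha₀ fun k => by
        rw [(hn t ht k).1, (hn t ht k).2.1])
      (fun t ht k => by rw [hωb]; exact (hn t ht k).2.2.2.2.2)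
      (fun t ht k => ⟨(hn t ht k).2.2.1, (hn t ht k).2.2.2.1, (hn t ht k).2.2.2.2.1.le⟩) hη hψ
    have h' : Tendsto (fun t => √(P.sumSq (a t - a₀))) atTop (𝓝 0) := by
      simpa using h.sqrt
    refine squeeze_zero (fun t => Metric.infDist_nonneg) (fun t => ?_) h'
    refine (Metric.infDist_le_dist_of_mem (hmem a₀ ha₀)).trans ?_
    rw [dist_eq_norm]
    exact P.norm_le_sqrt_sumSq _
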